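/- Let $(R,\mathfrak m)$ be a regular local ring of prime characteristic $p$ that is F-finite (i.e. $R^{1/p}$ is a finitely generated $R$-module). Let $I\subsetneq R$ be a radical ideal of height $h>0$ that is unmixed (every associated prime of $R/I$ has height $h$), and put $S=R/I$. Let $\mathfrak a_1,\dots,\mathfrak a_k$ be ideals of $R$ and $t_1,\dots,t_k>0$ real numbers. Definitions. Let $A$ be a reduced F-finite ring of characteristic $p$, let $\mathfrak b_1,\dots,\mathfrak b_n\subseteq A$ be ideals, $s_1,\dots,s_n>0$ real numbers, and let $A^\circ$ be the set of elements of $A$ lying in no minimal prime of $A$. For $q=p^e$ put $\mathfrak b(q)=\mathfrak b_1^{\lfloor s_1(q-1)\rfloor}\cdots\mathfrak b_n^{\lfloor s_n(q-1)\rfloor}$ (with $\mathfrak b_i^0=A$), and say that $d\in A$ *splits at $q$* if the $A$-linear map $A\to A^{1/q}$, $1\mapsto d^{1/q}$, splits. The pair $(A,\mathfrak b_1^{s_1}\cdots\mathfrak b_n^{s_n})$ is * *F-pure* if for all sufficiently large $q=p^e$ some $d\in\mathfrak b(q)$ splits at $q$; * *strongly F-regular* if for every $c\in A^\circ$ there are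 $q=p^e$ with $e\ge 1$ and $d\in\mathfrak b(q)$ such that $cd$ splits at $q$; * *purely F-regular* if for every $c\in A^\circ$ lying in no minimal prime of $\mathfrak b_1\cdots\mathfrak b_n$ and for all sufficiently large $q=p^e$ (depending on $c$) there is $d\in\mathfrak b(q)$ such that $cd$ splits at $q$. Then: 1. (a) Suppose, in the case that $S$ is a field, that moreover all $\mathfrak a_iS$ are nonzero. If $(S,(\mathfrak a_1S)^{t_1}\cdots(\mathfrak a_kS)^{t_k})$ is strongly F-regular, then $(R,I\,\mathfrak a_1^{t_1}\cdots\mathfrak a_k^{t_k})$ is purely F-regular. (b) If $(S,(\mathfrak a_1S)^{t_1}\cdots(\mathfrak a_kS)^{t_k})$ is F-pure, then $(R,I\,\mathfrak a_1^{t_1}\cdots\mathfrak a_k^{t_k})$ is F-pure. 2. (a) If $(R,I^h\mathfrak a_1^{t_1}\cdots\mathfrak a_k^{t_k})$ is F-pure, then $(S,(\mathfrak a_1S)^{t_1}\cdots(\mathfrak a_kS)^{t_k})$ is F-pure. (b) If every $\mathfrak a_i$ contains $I$ and $(R,I^h\mathfrak a_1^{t_1}\cdots\mathfrak a_k^{t_k})$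 is purely F-regular, then $(S,(\mathfrak a_1S)^{t_1}\cdots(\mathfrak a_kS)^{t_k})$ is strongly F-regular. -/

import Mathlib

/-- `FrobRoot R p e` is the ring `R^{1/q}`, `q = p ^ e`, of a ring `R` of characteristic `p`: the ring
`R` itself, viewed as an `R`-algebra through the `e`-fold iterated Frobenius. -/
def FrobRoot (R : Type*) (_p _e : ℕ) : Type _ := R

instance FrobRoot.instCommRing (R : Type*) [CommRing R] (p e : ℕ) : CommRing (FrobRoot R p e) :=
  inferInstanceAs (CommRing R)

/-- The tautological isomorphism `x ↦ x^{1/q}` from `R` to `R^{1/q}`. -/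
def FrobRoot.root (R : Type*) [CommRing R] (p e : ℕ) : R ≃+* FrobRoot R p e :=
  RingEquiv.refl R

/-- `R^{1/q}` is an `R`-algebra through `r ↦ (r ^ q)^{1/q}`. -/
instance FrobRoot.instAlgebra (R : Type*) [CommRing R] (p e : ℕ) [ExpChar R p] :
    Algebra R (FrobRoot R p e) :=
  ((FrobRoot.root R p e).toRingHom.comp (iterateFrobenius R p e)).toAlgebra

theorem FrobRoot.smul_root (R : Type*) [CommRing R] (p e : ℕ) [ExpChar R p] (r x : R) :
    r • FrobRoot.root R p e x = FrobRoot.root R p e (r ^ p ^ e * x) :=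
  rfl

/-- `R` is F-finite: `R^{1/p}` is a finitely generated `R`-module. -/
def IsFFinite (R : Type*) [CommRing R] (p : ℕ) [ExpChar R p] : Prop :=
  Module.Finite R (FrobRoot R p 1)

/-- The `R`-linear map `R → R^{1/q}`, `1 ↦ d^{1/q}`, splits. -/
def RootSplits {R : Type*} [CommRing R] (p e : ℕ) [ExpChar R p] (d : R) : Prop :=
  ∃ φ : FrobRoot R p e →ₗ[R] R,
    φ ∘ₗ LinearMap.toSpanSingleton R (FrobRoot R p e) (FrobRoot.root R p e d) = LinearMap.id

/-- `c ∈ R°`: the element `c` is in no minimal prime ideal of `R`. -/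
def MemCirc {R : Type*} [CommRing R] (c : R) : Prop :=
  ∀ P ∈ minimalPrimes R, c ∉ P

/-- The ideal `𝔞₁^⌊t₁(q-1)⌋ ⋯ 𝔞ₖ^⌊tₖ(q-1)⌋` for `q = p ^ e`. -/
noncomputable def floorPower {R : Type*} [CommRing R] (p : ℕ) {k : ℕ} (a : Fin k → Ideal R)
    (t : Fin k → ℝ) (e : ℕ) : Ideal R :=
  ∏ i, a i ^ ⌊t i * ((p : ℝ) ^ e - 1)⌋₊

/-- The pair `(R, 𝔞₁^{t₁} ⋯ 𝔞ₖ^{tₖ})` is F-pure. -/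
def IsFPurePair {R : Type*} [CommRing R] (p : ℕ) [ExpChar R p] {k : ℕ} (a : Fin k → Ideal R)
    (t : Fin k → ℝ) : Prop :=
  ∃ e₀ : ℕ, ∀ e : ℕ, e₀ ≤ e → ∃ d ∈ floorPower p a t e, RootSplits p e d

/-- The pair `(R, 𝔞₁^{t₁} ⋯ 𝔞ₖ^{tₖ})` is strongly F-regular. -/
def IsStronglyFRegularPair {R : Type*} [CommRing R] (p : ℕ) [ExpChar R p] {k : ℕ}
    (a : Fin k → Ideal R) (t : Fin k → ℝ) : Prop :=
  ∀ c : R, MemCirc c →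
    ∃ e : ℕ, 0 < e ∧ ∃ d ∈ floorPower p a t e, RootSplits p e (c * d)

/-- The pair `(R, 𝔞₁^{t₁} ⋯ 𝔞ₖ^{tₖ})` is purely F-regular. -/
def IsPurelyFRegularPair {R : Type*} [CommRing R] (p : ℕ) [ExpChar R p] {k : ℕ}
    (a : Fin k → Ideal R) (t : Fin k → ℝ) : Prop :=
  ∀ c : R, MemCirc c → (∀ P ∈ (∏ i, a i).minimalPrimes, c ∉ P) →
    ∃ e₀ : ℕ, ∀ e : ℕ, e₀ ≤ e → ∃ d ∈ floorPower p a t e, RootSplits p e (c * d)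

/-- The ideal `I` is unmixed: all associated primes of `R / I` have the same height as `I`. -/
def Ideal.IsHeightUnmixed {R : Type*} [CommRing R] (I : Ideal R) : Prop :=
  ∀ P ∈ associatedPrimes R (R ⧸ I), P.height = I.height

/-- A proper quotient of a ring of prime characteristic `p` has characteristic `p`. -/
theorem charP_quotient_of_ne_top {R : Type*} [CommRing R] (p : ℕ) [Fact p.Prime] [CharP R p]
    {I : Ideal R} (hI : I ≠ ⊤) : CharP (R ⧸ I) p := by
  have : Nontrivial (R ⧸ I) := Ideal.Quotient.nontrivial_iff.mpr hI
  refine (CharP.charP_iff_prime_eq_zero (R := R ⧸ I) (p := p) Fact.out).mpr ?_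
  rw [← map_natCast (Ideal.Quotient.mk I), CharP.cast_eq_zero, map_zero]

/-! Write `I^[q]` for the ideal generated by the `q`-th powers of elements of `I`, and `m` for the
maximal ideal. Over the regular ring `R` an element `d` splits at `q` exactly when `d ∉ m^[q]`.
Fedder's criterion says that the class of `d` splits at `q` in `S = R/I` exactly when `u d ∉ m^[q]`
for some `u ∈ (I^[q] : I)`. Everything therefore rests on placing this colon ideal between two
powers of `I`: `I^(h(q-1)) ⊆ (I^[q] : I) ⊆ I^(q-1)`. The right inclusion turns a splitting on `S`
into one on `R` (part 1), the left one does the converse (part 2).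

Fedder's criterion needs that `R^{1/q}` is free over `R` (`FrobRoot.free_of_isFFinite`) and that
`Hom_R(R^{1/q}, R)` is generated by one map (`IsRegularLocalRing.exists_frobenius_trace`); the
latter holds because the closed fibre `R/m^[q]` has simple socle.

Right inclusion: if `u I ⊆ I^[q]`, iteration and flatness of Frobenius put `f^(q-1)`, for a nonzero
`f ∈ I`, into `(I^(q-1) : u)^[q^n]` for every `n`. If `u ∉ I^(q-1)` this lies in `m^n`, so `f^(q-1)
= 0`, a contradiction.

Left inclusion: `I^(h(q-1)+1) ⊆ I^[q]` may be tested at the associated primes `Q` of `I^[q]`. By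
flatness these are associated primes of `I`, hence of height `h`. There `I` becomes the maximal
ideal of an `h`-dimensional regular local ring, and the pigeonhole principle applies. Regularity of
the localization comes from Kunz's theorem: flatness of Frobenius localizes, and it forces
regularity by Lech's length estimate.

Strong F-regularity provides a single `q`, pure F-regularity asks for all large `q`.
`IsStronglyFRegularPair.exists_forall_ge` bridges this, after showing that `S` is a domain and that
the ideals on `S` are nonzero. -/

/-! ### Minimal generators -/

open IsLocalRing in
/-- A finitely generated submodule over a local ring has generators that are linearly independent
modulo the maximal ideal. -/
theorem Submodule.FG.exists_minimal_generators {R M : Type*} [CommRing R] [IsLocalRing R]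
    [AddCommGroup M] [Module R M] {N : Submodule R M} (hN : N.FG) :
    ∃ x : Fin N.spanFinrank → M, span R (Set.range x) = N ∧
      ∀ b : Fin N.spanFinrank → R, ∑ i, b i • x i ∈ maximalIdeal R • N →
        ∀ i, b i ∈ maximalIdeal R := by
  obtain ⟨s, hs, hsN⟩ := hN.exists_span_finset_card_eq_spanFinrank
  let x : Fin N.spanFinrank → M := fun i => (s.equivFinOfCardEq hs).symm i
  have hx : Set.range x = s := by
    ext y
    simp only [Set.mem_range, x, Finset.mem_coe]
    exact ⟨fun ⟨i, hi⟩ => hi ▸ Subtype.coe_prop _,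
      fun hy => ⟨s.equivFinOfCardEq hs ⟨y, hy⟩, by simp⟩⟩
  have hxN : span R (Set.range x) = N := by rw [hx, hsN]
  refine ⟨x, hxN, fun b hb i => ?_⟩
  by_contra hi
  have hu : IsUnit (b i) := by simpa using hi
  obtain ⟨v, hv⟩ := hu.exists_left_inv
  -- If `b i` were a unit, `x i` would be redundant modulo `m N`; by Nakayama the other generators
  -- would span `N`, against minimality of their number.
  let N' : Submodule R M := span R (x '' {i}ᶜ)
  have hN'N : N' ≤ N := by
    rw [← hxN]
    exact span_mono (Set.image_subset_range _ _)
  have hle : N ≤ N' := by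
    refine le_of_le_smul_of_le_jacobson_bot (I := maximalIdeal R) hN
      (IsLocalRing.jacobson_eq_maximalIdeal (⊥ : Ideal R) bot_ne_top).ge ?_
    conv_lhs => rw [← hxN]
    rw [span_le]
    rintro _ ⟨j, rfl⟩
    by_cases hj : j = i
    · subst hj
      have h1 : x j = v • ∑ i, b i • x i - v • ∑ i ∈ Finset.univ.erase j, b i • x i := by
        rw [← Finset.add_sum_erase _ _ (Finset.mem_univ j), smul_add, add_sub_cancel_right,
          smul_smul, hv, one_smul]
      rw [SetLike.mem_coe, h1]
      refine sub_mem (mem_sup_right (smul_mem _ _ hb)) (mem_sup_left (smul_mem _ _ ?_))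
      exact sum_mem fun k hk => smul_mem _ _ (subset_span ⟨k, by simpa using hk, rfl⟩)
    · exact mem_sup_left (subset_span ⟨j, hj, rfl⟩)
  have h1 := spanFinrank_span_le_ncard_of_finite (R := R) ((Set.toFinite ({i}ᶜ : Set _)).image x)
  rw [show span R (x '' {i}ᶜ) = N from le_antisymm hN'N hle] at h1
  have h2 := Set.ncard_image_le (f := x) (Set.toFinite ({i}ᶜ : Set _))
  rw [Set.ncard_compl, Set.ncard_singleton, Nat.card_eq_fintype_card, Fintype.card_fin] at h2
  have := i.pos
  omega

/-! ### Regular local rings are domains -/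

namespace IsLocalRing

variable {R : Type*} [CommRing R] [IsLocalRing R]

theorem maximalIdeal_quotient_eq_map {I : Ideal R} [IsLocalRing (R ⧸ I)] :
    maximalIdeal (R ⧸ I) = (maximalIdeal R).map (Ideal.Quotient.mk I) := by
  have : IsLocalHom (Ideal.Quotient.mk I) := .of_surjective _ Ideal.Quotient.mk_surjective
  refine le_antisymm (fun x hx => ?_) (((local_hom_TFAE (Ideal.Quotient.mk I)).out 0 2).mp this)
  obtain ⟨y, rfl⟩ := Ideal.Quotient.mk_surjective x
  refine Ideal.mem_map_of_mem _ ?_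
  rw [mem_maximalIdeal, mem_nonunits_iff] at hx ⊢
  exact fun h => hx (h.map _)

/-- Exchange: since `x ∉ m²`, some coefficient of `x` in terms of `s` is a unit, and the
corresponding generator can be traded for `x`. -/
theorem exists_finset_span_insert_eq_maximalIdeal {s : Finset R}
    (hs : Ideal.span (s : Set R) = maximalIdeal R) {x : R} (hx : x ∈ maximalIdeal R)
    (hx2 : x ∉ maximalIdeal R ^ 2) :
    ∃ t : Finset R, t.card + 1 = s.card ∧
      Ideal.span (insert x (t : Set R)) = maximalIdeal R := by
  classical
  rw [← hs] at hx
  obtain ⟨c, hc⟩ := Submodule.mem_span_finset'.mp hx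
  have hmem : ∀ y ∈ s, y ∈ maximalIdeal R := fun y hy => hs ▸ Ideal.subset_span hy
  obtain ⟨y, hy⟩ : ∃ y : s, c y ∉ maximalIdeal R := by
    by_contra! h
    refine hx2 (hc ▸ sum_mem fun y _ => ?_)
    rw [pow_two]
    exact Ideal.mul_mem_mul (h y) (hmem _ y.2)
  obtain ⟨v, hv⟩ := (show IsUnit (c y) by simpa using hy).exists_left_inv
  refine ⟨s.erase y, by rw [Finset.card_erase_add_one y.2], le_antisymm ?_ ?_⟩
  · rw [Ideal.span_le]
    rintro z (rfl | hz)
    · exact hs ▸ hx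
    · exact hmem z (Finset.mem_of_mem_erase hz)
  · rw [← hs, Ideal.span_le]
    intro z hz
    by_cases hzy : z = y
    · subst hzy
      have h1 : (y : R) = v * x - v * ∑ z ∈ Finset.univ.erase y, c z • (z : R) := by
        rw [← hc, ← Finset.add_sum_erase _ _ (Finset.mem_univ y), smul_eq_mul, mul_add,
          add_sub_cancel_right, ← mul_assoc, hv, one_mul]
      suffices h2 : v * x - v * ∑ z ∈ Finset.univ.erase y, c z • (z : R) ∈
          Ideal.span (insert x ((s.erase (y : R) : Finset R) : Set R)) by rwa [← h1] at h2
      refine sub_mem (Ideal.mul_mem_left _ _ (Ideal.subset_span (Set.mem_insert _ _)))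
        (Ideal.mul_mem_left _ _ (sum_mem fun z hz => Ideal.mul_mem_left _ _
          (Ideal.subset_span (Set.mem_insert_of_mem _ ?_))))
      simp only [Finset.mem_erase, Finset.mem_univ, and_true] at hz
      exact Finset.mem_coe.mpr (Finset.mem_erase.mpr ⟨fun h => hz (Subtype.ext h), z.2⟩)
    · exact Ideal.subset_span (Set.mem_insert_of_mem _ (by simp [hzy, Finset.mem_coe.mp hz]))

theorem maximalIdeal_not_le_of_mem_minimalPrimes (hdim : 1 ≤ ringKrullDim R) {P : Ideal R}
    (hP : P ∈ minimalPrimes R) : ¬ maximalIdeal R ≤ P := by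
  intro h
  have hp : P.IsPrime := hP.1.1
  have h1 : P = maximalIdeal R := le_antisymm (le_maximalIdeal hp.ne_top) h
  subst h1
  have h2 : (maximalIdeal R).height = 0 := Ideal.height_eq_zero_iff.mpr hP
  rw [← maximalIdeal_height_eq_ringKrullDim, h2] at hdim
  exact absurd hdim (by decide)

variable [IsNoetherianRing R]

theorem exists_mem_maximalIdeal_notMem_sq (hdim : 1 ≤ ringKrullDim R) :
    ∃ x ∈ maximalIdeal R, x ∉ maximalIdeal R ^ 2 ∧ ∀ P ∈ minimalPrimes R, x ∉ P := by
  by_contra! hcon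
  have hfin : (insert (maximalIdeal R ^ 2) (minimalPrimes R)).Finite :=
    (Ideal.finite_minimalPrimes_of_isNoetherianRing R ⊥).insert _
  -- Prime avoidance tolerates two non-prime ideals; `m²` fills both slots.
  have := (Ideal.subset_union_prime_finite hfin (f := id) (I := maximalIdeal R)
    (maximalIdeal R ^ 2) (maximalIdeal R ^ 2) ?_).mp ?_
  · obtain ⟨P, hP, hle⟩ := this
    rcases hP with rfl | hP
    · have hbot : maximalIdeal R = ⊥ := by
        refine Submodule.eq_bot_of_le_smul_of_le_jacobson_bot (maximalIdeal R) _
          (IsNoetherian.noetherian _) (by simpa [pow_two] using hle)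
          (jacobson_eq_maximalIdeal (⊥ : Ideal R) bot_ne_top).ge
      obtain ⟨P, hP⟩ := Ideal.nonempty_minimalPrimes (I := (⊥ : Ideal R)) bot_ne_top
      exact maximalIdeal_not_le_of_mem_minimalPrimes hdim hP (hbot ▸ bot_le)
    · exact maximalIdeal_not_le_of_mem_minimalPrimes hdim hP hle
  · rintro P (rfl | hP) h1 -
    · exact absurd rfl h1
    · exact hP.1.1
  · intro x hx
    by_cases hx2 : x ∈ maximalIdeal R ^ 2
    · exact Set.mem_biUnion (Set.mem_insert _ _) hx2
    · obtain ⟨P, hP, hxP⟩ := hcon x hx hx2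
      exact Set.mem_biUnion (Set.mem_insert_of_mem _ hP) hxP

/-- Cut by `x ∈ m \ m²` outside all minimal primes: the quotient has one generator and at most one
dimension less, so `(x)` is prime by induction. A minimal prime `P ⊆ (x)` satisfies `P = xP` because
`x ∉ P`, so `P = 0` by Nakayama. -/
theorem isDomain_of_card_le_ringKrullDim {n : ℕ} :
    ∀ (R : Type*) [CommRing R] [IsLocalRing R] [IsNoetherianRing R] (s : Finset R),
      s.card ≤ n → Ideal.span (s : Set R) = maximalIdeal R → (n : WithBot ℕ∞) ≤ ringKrullDim R →
        IsDomain R := by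
  induction n with
  | zero =>
    intro R _ _ _ s hn hs hdim
    have : s = ∅ := by simpa using hn
    subst this
    have h : maximalIdeal R = ⊥ := by simpa using hs.symm
    exact ((isField_iff_maximalIdeal_eq).mpr h).isDomain
  | succ n ih =>
    intro R _ _ _ s hn hs hdim
    have hdim1 : 1 ≤ ringKrullDim R := le_trans (by norm_cast; omega) hdim
    obtain ⟨x, hx, hx2, hxP⟩ := exists_mem_maximalIdeal_notMem_sq hdim1
    obtain ⟨t, htc, ht⟩ := exists_finset_span_insert_eq_maximalIdeal hs hx hx2
    classical
    have hne : Ideal.span {x} ≠ ⊤ :=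
      fun h => Ideal.IsPrime.ne_top' (top_le_iff.mp (h ▸ (Ideal.span_singleton_le_iff_mem _).mpr hx))
    have : Nontrivial (R ⧸ Ideal.span {x}) := Ideal.Quotient.nontrivial_iff.mpr hne
    have : IsLocalRing (R ⧸ Ideal.span {x}) :=
      .of_surjective' (Ideal.Quotient.mk _) Ideal.Quotient.mk_surjective
    have hdom : IsDomain (R ⧸ Ideal.span {x}) := by
      refine ih _ (t.image (Ideal.Quotient.mk _)) (Finset.card_image_le.trans (by omega)) ?_ ?_
      · rw [maximalIdeal_quotient_eq_map, ← ht, Ideal.map_span, Set.image_insert_eq,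
          Finset.coe_image, (Ideal.Quotient.eq_zero_iff_mem).mpr (Ideal.mem_span_singleton_self x),
          Ideal.span_insert_zero]
      · have h1 := ringKrullDim_le_ringKrullDim_quotient_add_card {x}
          (by simpa [IsLocalRing.ringJacobson_eq_maximalIdeal] using hx)
        have h2 := hdim.trans h1
        rw [Finset.coe_singleton, Finset.card_singleton] at h2
        push_cast at h2
        exact (ENat.WithBot.add_le_add_one_right_iff).mp h2
    have hprime : (Ideal.span {x}).IsPrime := (Ideal.Quotient.isDomain_iff_prime _).mp hdom
    obtain ⟨P, hP, hPx⟩ := Ideal.exists_minimalPrimes_le (I := (⊥ : Ideal R)) (J := Ideal.span {x})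
      bot_le
    have hPp : P.IsPrime := hP.1.1
    have hbot : P = ⊥ := by
      refine Submodule.eq_bot_of_le_smul_of_le_jacobson_bot (maximalIdeal R) _
          (IsNoetherian.noetherian _) (fun y hy => ?_)
          (jacobson_eq_maximalIdeal (⊥ : Ideal R) bot_ne_top).ge
      obtain ⟨z, rfl⟩ := Ideal.mem_span_singleton.mp (hPx hy)
      exact Submodule.smul_mem_smul hx ((hPp.mem_or_mem hy).resolve_left (hxP P hP))
    subst hbot
    exact IsDomain.of_bot_isPrime R

variable {n : ℕ} {x : Fin n → R}

theorem isPrime_span_image (hx : Ideal.span (Set.range x) = maximalIdeal R)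
    (hdim : (n : WithBot ℕ∞) ≤ ringKrullDim R) (T : Finset (Fin n)) :
    (Ideal.span (x '' T)).IsPrime := by
  classical
  have hTm : x '' T ⊆ maximalIdeal R :=
    fun _ h => hx ▸ Ideal.subset_span (Set.image_subset_range _ _ h)
  have hne : Ideal.span (x '' T) ≠ ⊤ := fun h =>
    Ideal.IsPrime.ne_top' (top_le_iff.mp (h ▸ Ideal.span_le.mpr hTm))
  have : Nontrivial (R ⧸ Ideal.span (x '' T)) := Ideal.Quotient.nontrivial_iff.mpr hne
  have : IsLocalRing (R ⧸ Ideal.span (x '' T)) :=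
      .of_surjective' (Ideal.Quotient.mk _) Ideal.Quotient.mk_surjective
  rw [← Ideal.Quotient.isDomain_iff_prime]
  refine isDomain_of_card_le_ringKrullDim (n := Tᶜ.card) _
    (Tᶜ.image fun i => Ideal.Quotient.mk _ (x i)) Finset.card_image_le ?_ ?_
  · rw [maximalIdeal_quotient_eq_map, ← hx, Ideal.map_span]
    refine le_antisymm (Ideal.span_mono ?_) (Ideal.span_le.mpr ?_)
    · simp only [Finset.coe_image, ← Set.range_comp]
      exact Set.image_subset_range _ _
    · rintro _ ⟨_, ⟨i, rfl⟩, rfl⟩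
      by_cases hi : i ∈ T
      · rw [Ideal.Quotient.eq_zero_iff_mem.mpr (Ideal.subset_span (Set.mem_image_of_mem x hi))]
        exact zero_mem _
      · exact Ideal.subset_span (Finset.mem_coe.mpr (Finset.mem_image_of_mem _ (Finset.mem_compl.mpr hi)))
  · have h1 := ringKrullDim_le_ringKrullDim_quotient_add_card (T.image x)
      (by simpa [IsLocalRing.ringJacobson_eq_maximalIdeal] using hTm)
    rw [Finset.coe_image] at h1
    have h2 := hdim.trans (h1.trans (add_le_add_right
      (Nat.cast_le.mpr (Finset.card_image_le (f := x) (s := T))) _))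
    have h3 : n = Tᶜ.card + T.card := by
      rw [Finset.card_compl_add_card, Fintype.card_fin]
    replace h2 := (congrArg (Nat.cast : ℕ → WithBot ℕ∞) h3).ge.trans h2
    push_cast at h2
    exact (ENat.WithBot.add_le_add_natCast_right_iff).mp h2

/-- Otherwise `n - 1` elements would generate `m`, fewer than the dimension allows. -/
theorem notMem_span_image (hx : Ideal.span (Set.range x) = maximalIdeal R)
    (hdim : (n : WithBot ℕ∞) ≤ ringKrullDim R) {T : Finset (Fin n)} {i : Fin n} (hi : i ∉ T) :
    x i ∉ Ideal.span (x '' T) := by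
  intro hmem
  have h1 : maximalIdeal R = Ideal.span (x '' {i}ᶜ) := by
    rw [← hx]
    refine le_antisymm (Ideal.span_le.mpr ?_) (Ideal.span_mono (Set.image_subset_range _ _))
    rintro _ ⟨j, rfl⟩
    by_cases hj : j = i
    · subst hj
      exact Ideal.span_mono (Set.image_mono fun k hk => by rintro rfl; exact hi hk) hmem
    · exact Ideal.subset_span ⟨j, hj, rfl⟩
  have h2 := hdim.trans (ringKrullDim_le_spanFinrank_maximalIdeal R)
  rw [h1] at h2
  have h3 := Submodule.spanFinrank_span_le_ncard_of_finite (R := R)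
    ((Set.toFinite ({i}ᶜ : Set _)).image x)
  have h4 := Set.ncard_image_le (f := x) (Set.toFinite ({i}ᶜ : Set _))
  rw [Set.ncard_compl, Set.ncard_singleton, Nat.card_eq_fintype_card, Fintype.card_fin] at h4
  have h5 : n ≤ (Ideal.span (x '' {i}ᶜ)).spanFinrank := by exact_mod_cast h2
  have := i.pos
  simp only [Ideal.span] at h5
  omega

end IsLocalRing

theorem isDomain_of_isRegularLocalRing (R : Type*) [CommRing R] [IsRegularLocalRing R] :
    IsDomain R := by
  obtain ⟨s, hs, hsm⟩ := (IsNoetherian.noetherian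
    (IsLocalRing.maximalIdeal R)).exists_span_finset_card_eq_spanFinrank
  exact IsLocalRing.isDomain_of_card_le_ringKrullDim R s hs.le hsm
    IsRegularLocalRing.spanFinrank_maximalIdeal.le

/-! ### Powers of parameters: regular sequences and socles -/

namespace Ideal

variable {R : Type*} [CommRing R]

theorem mem_of_pow_mul_mem {J : Ideal R} {x : R} (hx : ∀ y, x * y ∈ J → y ∈ J) (a : ℕ) :
    ∀ y, x ^ a * y ∈ J → y ∈ J := by
  induction a with
  | zero => simp
  | succ a ih => exact fun y hy => ih y (hx _ (by rwa [← mul_assoc, ← pow_succ']))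

/-- Modulo `J`, the quotient by `x ^ a` is filtered by copies of the quotient by `x`, so a
nonzerodivisor modulo `J + (x)` remains one modulo `J + (x ^ a)`. -/
theorem mem_sup_span_pow_of_mul_mem {J : Ideal R} {x z : R} (hx : ∀ y, x * y ∈ J → y ∈ J)
    (hz : ∀ y, z * y ∈ J ⊔ span {x} → y ∈ J ⊔ span {x}) (a : ℕ) :
    ∀ y, z * y ∈ J ⊔ span {x ^ a} → y ∈ J ⊔ span {x ^ a} := by
  induction a with
  | zero => simp
  | succ a ih =>
    intro y hy
    have h1 : y ∈ J ⊔ span {x} := hz y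
      (sup_le_sup_left (span_singleton_le_span_singleton.mpr (dvd_pow_self x a.succ_ne_zero)) J hy)
    obtain ⟨j, hj, w, hw, rfl⟩ := Submodule.mem_sup.mp h1
    obtain ⟨y', rfl⟩ := mem_span_singleton.mp hw
    obtain ⟨j', hj', w', hw', he⟩ := Submodule.mem_sup.mp hy
    obtain ⟨c, rfl⟩ := mem_span_singleton.mp hw'
    have h2 : z * y' - x ^ a * c ∈ J := by
      refine hx _ ?_
      have : x * (z * y' - x ^ a * c) = j' - z * j := by
        linear_combination -he
      rw [this]
      exact sub_mem hj' (J.mul_mem_left _ hj)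
    have h3 : y' ∈ J ⊔ span {x ^ a} := by
      refine ih y' ?_
      have : z * y' = (z * y' - x ^ a * c) + x ^ a * c := by ring
      rw [this]
      exact Submodule.add_mem_sup h2 (mul_mem_right _ _ (mem_span_singleton_self _))
    obtain ⟨j₂, hj₂, w₂, hw₂, rfl⟩ := Submodule.mem_sup.mp h3
    obtain ⟨c₂, rfl⟩ := mem_span_singleton.mp hw₂
    have : j + x * (j₂ + x ^ a * c₂) = (j + x * j₂) + x ^ (a + 1) * c₂ := by ring
    rw [this]
    exact Submodule.add_mem_sup (add_mem hj (J.mul_mem_left _ hj₂))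
      (mul_mem_right _ _ (mem_span_singleton_self _))

/-- If the socle of `R / (J + (x))` is generated by `s`, then the socle of `R / (J + (x ^ (a + 1)))`
is generated by `x ^ a * s`. -/
theorem socle_sup_span_pow {m J : Ideal R} {x s : R} (hxm : x ∈ m) (hx : ∀ y, x * y ∈ J → y ∈ J)
    (hs : ∀ y, (∀ z ∈ m, z * y ∈ J ⊔ span {x}) → y ∈ J ⊔ span {x} ⊔ span {s}) (a : ℕ) :
    ∀ y, (∀ z ∈ m, z * y ∈ J ⊔ span {x ^ (a + 1)}) →
      y ∈ J ⊔ span {x ^ (a + 1)} ⊔ span {x ^ a * s} := by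
  intro y hy
  obtain ⟨j, hj, w, hw, he⟩ := Submodule.mem_sup.mp (hy x hxm)
  obtain ⟨c, rfl⟩ := mem_span_singleton.mp hw
  -- As `x` itself kills a socle element, cancelling `x` shows `y ≡ x ^ a * c` modulo `J`; then `c`
  -- represents a socle element modulo `J + (x)`.
  have h1 : y - x ^ a * c ∈ J := by
    refine hx _ ?_
    have : x * (y - x ^ a * c) = j := by linear_combination -he
    rwa [this]
  have h2 : c ∈ J ⊔ span {x} ⊔ span {s} := by
    refine hs c fun z hz => ?_
    obtain ⟨j', hj', w', hw', he'⟩ := Submodule.mem_sup.mp (hy z hz)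
    obtain ⟨d, rfl⟩ := mem_span_singleton.mp hw'
    have h3 : z * c - x * d ∈ J := by
      refine mem_of_pow_mul_mem hx a _ ?_
      have : x ^ a * (z * c - x * d) = j' - z * (y - x ^ a * c) := by linear_combination -he'
      rw [this]
      exact sub_mem hj' (J.mul_mem_left _ h1)
    have : z * c = (z * c - x * d) + x * d := by ring
    rw [this]
    exact Submodule.add_mem_sup h3 (mul_mem_right _ _ (mem_span_singleton_self _))
  obtain ⟨u, hu, v, hv, rfl⟩ := Submodule.mem_sup.mp h2
  obtain ⟨j₂, hj₂, w₂, hw₂, rfl⟩ := Submodule.mem_sup.mp hu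
  obtain ⟨c₂, rfl⟩ := mem_span_singleton.mp hw₂
  obtain ⟨d₂, rfl⟩ := mem_span_singleton.mp hv
  have : y = ((y - x ^ a * (j₂ + x * c₂ + s * d₂)) + x ^ a * j₂ + x ^ (a + 1) * c₂) +
      x ^ a * s * d₂ := by ring
  rw [this]
  exact Submodule.add_mem_sup (Submodule.add_mem_sup (add_mem h1 (J.mul_mem_left _ hj₂))
    (mul_mem_right _ _ (mem_span_singleton_self _))) (mul_mem_right _ _ (mem_span_singleton_self _))

theorem mem_of_forall_mem_sup_pow [IsLocalRing R] [IsNoetherianRing R] {J : Ideal R} {r : R}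
    (h : ∀ k : ℕ, r ∈ J ⊔ IsLocalRing.maximalIdeal R ^ k) : r ∈ J := by
  have h1 := iInf_pow_smul_eq_bot_of_isLocalRing (M := R ⧸ J) (IsLocalRing.maximalIdeal R)
    IsPrime.ne_top'
  rw [← Quotient.eq_zero_iff_mem, ← Submodule.mem_bot R, ← h1, Submodule.mem_iInf]
  intro k
  obtain ⟨j, hj, w, hw, rfl⟩ := Submodule.mem_sup.mp (h k)
  rw [map_add, Quotient.eq_zero_iff_mem.mpr hj, zero_add]
  have : Quotient.mk J w = w • (1 : R ⧸ J) := by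
    rw [Algebra.smul_def, mul_one]; rfl
  rw [this]
  exact Submodule.smul_mem_smul hw Submodule.mem_top

end Ideal

theorem Ideal.map_iterateFrobenius_span_image {R ι : Type*} [CommRing R] (p e : ℕ) [ExpChar R p]
    (x : ι → R) (T : Set ι) :
    (Ideal.span (x '' T)).map (iterateFrobenius R p e) =
      Ideal.span ((fun j => x j ^ p ^ e) '' T) := by
  rw [Ideal.map_span, Set.image_image]
  rfl

namespace IsLocalRing

variable {R : Type*} [CommRing R] [IsLocalRing R] [IsNoetherianRing R] {n : ℕ} {x : Fin n → R}

/-- With all exponents `1` the ideal is prime and misses `x i`. Exponents are then raised one index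
at a time; `U` holds the indices whose exponent may differ from `1`. The induction step needs both
`x j` and `x i` to be nonzerodivisors, so `T` and `i` stay quantified. -/
theorem mem_span_pow_image_of_mul_mem (hx : Ideal.span (Set.range x) = maximalIdeal R)
    (hdim : (n : WithBot ℕ∞) ≤ ringKrullDim R) (a : Fin n → ℕ) (T : Finset (Fin n)) {i : Fin n}
    (hi : i ∉ T) :
    ∀ y, x i * y ∈ Ideal.span ((fun j => x j ^ a j) '' T) →
      y ∈ Ideal.span ((fun j => x j ^ a j) '' T) := by
  suffices key : ∀ (U : Finset (Fin n)) (a : Fin n → ℕ), (∀ j ∉ U, a j = 1) →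
      ∀ (T : Finset (Fin n)) (i : Fin n), i ∉ T → ∀ y,
        x i * y ∈ Ideal.span ((fun j => x j ^ a j) '' T) →
          y ∈ Ideal.span ((fun j => x j ^ a j) '' T) from
    key Finset.univ a (by simp) T i hi
  intro U
  induction U using Finset.induction_on with
  | empty =>
    intro a ha T i hi y hy
    simp only [ha _ (Finset.notMem_empty _), pow_one] at hy ⊢
    exact ((isPrime_span_image hx hdim T).mem_or_mem hy).resolve_left
      (notMem_span_image hx hdim hi)
  | insert j U hj ih =>
    intro a ha T i hi y hy
    let a' := Function.update a j 1
    have ha' : ∀ k ∉ U, a' k = 1 := by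
      intro k hk
      by_cases hkj : k = j
      · simp [a', hkj]
      · simpa [a', hkj] using ha k (by simp [hkj, hk])
    have heq : ∀ T' : Finset (Fin n), j ∉ T' →
        ((fun k => x k ^ a k) '' T' : Set R) = (fun k => x k ^ a' k) '' T' := by
      intro T' hT'
      refine Set.image_congr fun k hk => ?_
      have : k ≠ j := by rintro rfl; exact hT' hk
      simp [a', this]
    by_cases hjT : j ∈ T
    · have hins : ∀ b : Fin n → ℕ, Ideal.span ((fun k => x k ^ b k) '' T) =
          Ideal.span ((fun k => x k ^ b k) '' (T.erase j)) ⊔ Ideal.span {x j ^ b j} := by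
        intro b
        rw [← Ideal.span_union, Set.union_singleton, ← Set.image_insert_eq (f := fun k => x k ^ b k), ← Finset.coe_insert,
          Finset.insert_erase hjT]
      rw [hins, heq _ (Finset.notMem_erase j T)] at hy ⊢
      refine Ideal.mem_sup_span_pow_of_mul_mem (ih a' ha' _ j (Finset.notMem_erase j T))
        (fun w hw => ?_) (a j) y hy
      have h1 := ih a' ha' T i hi w
      rw [hins] at h1
      simp only [a', Function.update_self, pow_one] at h1 hw ⊢
      exact h1 hw
    · rw [heq T hjT] at hy ⊢
      exact ih a' ha' T i hi y hy

/-- The socle of a regular local ring modulo powers of a regular system of parameters is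
principal. -/
theorem exists_socle_generator (hx : Ideal.span (Set.range x) = maximalIdeal R)
    (hdim : (n : WithBot ℕ∞) ≤ ringKrullDim R) (a : Fin n → ℕ) (ha : ∀ i, 0 < a i) :
    ∃ s, (∀ z ∈ maximalIdeal R, z * s ∈ Ideal.span (Set.range fun j => x j ^ a j)) ∧
      ∀ y, (∀ z ∈ maximalIdeal R, z * y ∈ Ideal.span (Set.range fun j => x j ^ a j)) →
        y ∈ Ideal.span (Set.range fun j => x j ^ a j) ⊔ Ideal.span {s} := by
  suffices key : ∀ (U : Finset (Fin n)) (a : Fin n → ℕ), (∀ i, 0 < a i) → (∀ j ∉ U, a j = 1) →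
      ∃ s, (∀ z ∈ maximalIdeal R, z * s ∈ Ideal.span (Set.range fun j => x j ^ a j)) ∧
        ∀ y, (∀ z ∈ maximalIdeal R, z * y ∈ Ideal.span (Set.range fun j => x j ^ a j)) →
          y ∈ Ideal.span (Set.range fun j => x j ^ a j) ⊔ Ideal.span {s} from
    key Finset.univ a ha (by simp)
  intro U
  induction U using Finset.induction_on with
  | empty => 
    intro a _ ha
    have : (fun j => x j ^ a j) = x := funext fun j => by
      rw [ha j (Finset.notMem_empty j), pow_one]
    rw [this, hx]
    exact ⟨1, by simp⟩
  | insert j U hj ih =>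
    intro a ha0 ha
    let a' := Function.update a j 1
    have ha' : ∀ k ∉ U, a' k = 1 := by
      intro k hk
      by_cases hkj : k = j
      · simp [a', hkj]
      · simpa [a', hkj] using ha k (by simp [hkj, hk])
    have ha0' : ∀ k, 0 < a' k := by
      intro k
      by_cases hkj : k = j
      · simp [a', hkj]
      · simpa [a', hkj] using ha0 k
    have hins : ∀ b : Fin n → ℕ, Ideal.span (Set.range fun k => x k ^ b k) =
        Ideal.span ((fun k => x k ^ b k) '' (Finset.univ.erase j : Finset (Fin n))) ⊔
          Ideal.span {x j ^ b j} := by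
      intro b
      rw [← Ideal.span_union, Set.union_singleton, ← Set.image_insert_eq (f := fun k => x k ^ b k), ← Finset.coe_insert,
        Finset.insert_erase (Finset.mem_univ j), Finset.coe_univ, Set.image_univ]
    have heq : ((fun k => x k ^ a k) '' (Finset.univ.erase j : Finset (Fin n)) : Set R) =
        (fun k => x k ^ a' k) '' (Finset.univ.erase j : Finset (Fin n)) := by
      refine Set.image_congr fun k hk => ?_
      have : k ≠ j := by simpa using hk
      simp [a', this]
    obtain ⟨s, hms, hs⟩ := ih a' ha0' ha'
    obtain ⟨b, hb⟩ := Nat.exists_eq_add_one.mpr (ha0 j)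
    -- Raising the exponent of `x j` from `1` to `b + 1` multiplies the socle generator by `x j ^
    -- b`.
    refine ⟨x j ^ b * s, ?_⟩
    rw [hins] at hms hs
    simp only [a', Function.update_self, pow_one] at hms hs
    rw [hins, heq, hb]
    refine ⟨fun z hz => ?_, Ideal.socle_sup_span_pow (hx ▸ Ideal.subset_span ⟨j, rfl⟩)
      (mem_span_pow_image_of_mul_mem hx hdim a' _ (Finset.notMem_erase j _)) hs b⟩
    obtain ⟨y, hy, w, hw, h⟩ := Submodule.mem_sup.mp (hms z hz)
    obtain ⟨c, rfl⟩ := Ideal.mem_span_singleton.mp hw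
    have : z * (x j ^ b * s) = x j ^ b * y + x j ^ (b + 1) * c := by linear_combination -x j ^ b * h
    rw [this]
    exact Submodule.add_mem_sup (Ideal.mul_mem_left _ _ hy)
      (Ideal.mul_mem_right _ _ (Ideal.mem_span_singleton_self _))

/-! ### Freeness of `R^{1/q}` over a regular local ring -/

variable (p e : ℕ) [ExpChar R p]

/-- Elements that are linearly independent over `R` modulo the maximal ideal, for the module
structure through the Frobenius, are linearly independent. -/
theorem eq_zero_of_sum_pow_mul_eq_zero (hx : Ideal.span (Set.range x) = maximalIdeal R)
    (hdim : (n : WithBot ℕ∞) ≤ ringKrullDim R) {N : ℕ} (b : Fin N → R)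
    (hb : ∀ r : Fin N → R,
      ∑ l, r l ^ p ^ e * b l ∈ (maximalIdeal R).map (iterateFrobenius R p e) →
        ∀ l, r l ∈ maximalIdeal R) (r : Fin N → R) (hr : ∑ l, r l ^ p ^ e * b l = 0) (l : Fin N) :
    r l = 0 := by
  -- Independence modulo `m` is lifted to independence by removing the parameters one by one: `U` is
  -- the set of parameters already removed.
  suffices key : ∀ (U : Finset (Fin n)) (r : Fin N → R),
      ∑ l, r l ^ p ^ e * b l ∈ (Ideal.span (x '' (Uᶜ : Finset (Fin n)))).map
        (iterateFrobenius R p e) → ∀ l, r l ∈ Ideal.span (x '' (Uᶜ : Finset (Fin n))) by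
    have := key Finset.univ r (hr ▸ zero_mem _) l
    simpa using this
  intro U
  induction U using Finset.induction_on with
  | empty =>
    simpa [hx] using hb
  | insert i U hi ih =>
    set T : Finset (Fin n) := (insert i U)ᶜ with hT
    have hiT : i ∉ T := by simp [hT]
    have hUT : Uᶜ = insert i T := by
      ext j
      by_cases hj : j = i <;> simp [hT, hj, hi]
    rw [hUT, Finset.coe_insert, Set.image_insert_eq, Ideal.span_insert] at ih
    -- Modulo `(x_T)` one has `r l = x i * s l`, and cancelling `x i ^ q` shows that `s` satisfies
    -- the same hypothesis as `r`. Repeating this puts `r l` in `(x_T) + m ^ k` for all `k`, and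
    -- Krull's intersection theorem finishes.
    suffices key : ∀ (k : ℕ) (r : Fin N → R),
        ∑ l, r l ^ p ^ e * b l ∈ (Ideal.span (x '' T)).map (iterateFrobenius R p e) →
          ∀ l, r l ∈ Ideal.span (x '' T) ⊔ maximalIdeal R ^ k from
      fun r hr l => Ideal.mem_of_forall_mem_sup_pow fun k => key k r hr l
    intro k
    induction k with
    | zero => simp
    | succ k ihk =>
      intro r hr
      have h1 := ih r (Ideal.map_mono le_sup_right hr)
      have h2 : ∀ l, ∃ s, r l - x i * s ∈ Ideal.span (x '' T) := by
        intro l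
        obtain ⟨w, hw, j, hj, h⟩ := Submodule.mem_sup.mp (h1 l)
        obtain ⟨s, rfl⟩ := Ideal.mem_span_singleton.mp hw
        exact ⟨s, by rwa [← h, add_sub_cancel_left]⟩
      choose s hs using h2
      have h3 : x i ^ p ^ e * ∑ l, s l ^ p ^ e * b l ∈
          (Ideal.span (x '' T)).map (iterateFrobenius R p e) := by
        have h4 : x i ^ p ^ e * ∑ l, s l ^ p ^ e * b l = ∑ l, r l ^ p ^ e * b l -
            ∑ l, (r l - x i * s l) ^ p ^ e * b l := by
          rw [Finset.mul_sum, ← Finset.sum_sub_distrib]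
          refine Finset.sum_congr rfl fun l _ => ?_
          rw [sub_pow_expChar_pow, mul_pow]
          ring
        rw [h4]
        exact sub_mem hr (sum_mem fun l _ => Ideal.mul_mem_right _ _
          (Ideal.mem_map_of_mem (iterateFrobenius R p e) (hs l)))
      rw [Ideal.map_iterateFrobenius_span_image] at h3
      have h5 := Ideal.mem_of_pow_mul_mem
        (mem_span_pow_image_of_mul_mem hx hdim (fun _ => p ^ e) T hiT) _ _ h3
      rw [← Ideal.map_iterateFrobenius_span_image] at h5
      intro l
      have h6 := ihk s h5 l
      have hxi : x i ∈ maximalIdeal R := hx ▸ Ideal.subset_span ⟨i, rfl⟩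
      obtain ⟨j, hj, w, hw, h⟩ := Submodule.mem_sup.mp h6
      have h7 : r l = ((r l - x i * s l) + x i * j) + x i * w := by rw [← h]; ring
      rw [h7]
      refine Submodule.add_mem_sup (add_mem (hs l) (Ideal.mul_mem_left _ _ hj)) ?_
      rw [pow_succ']
      exact Ideal.mul_mem_mul hxi hw

end IsLocalRing

namespace FrobRoot

variable {R : Type*} [CommRing R] (p e : ℕ) [ExpChar R p]

theorem root_mem_map_algebraMap {I : Ideal R} {z : R} :
    root R p e z ∈ I.map (algebraMap R (FrobRoot R p e)) ↔
      z ∈ I.map (iterateFrobenius R p e) := Iff.rfl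

theorem finite_of_isFFinite (h : IsFFinite R p) : Module.Finite R (FrobRoot R p e) := by
  have h1 : (frobenius R p).Finite := by
    have : (iterateFrobenius R p 1).Finite := h
    rwa [iterateFrobenius_one] at this
  suffices h2 : (iterateFrobenius R p e).Finite from h2
  induction e with
  | zero => rw [iterateFrobenius_zero]; exact RingHom.Finite.id R
  | succ e ih =>
    have : iterateFrobenius R p (e + 1) = (frobenius R p).comp (iterateFrobenius R p e) := by
      ext r
      simp [iterateFrobenius_def, frobenius_def, ← pow_mul, pow_succ]
    rw [this]
    exact h1.comp ih

-- One direction of Kunz's theorem: a minimal generating set of `R^{1/q}` is independent on the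
-- closed fibre, and regularity of the parameters lifts this independence to `R`.
open IsLocalRing in
theorem free_of_isFFinite [IsRegularLocalRing R] (h : IsFFinite R p) :
    Module.Free R (FrobRoot R p e) := by
  obtain ⟨x, hx, -⟩ := (IsNoetherian.noetherian (maximalIdeal R)).exists_minimal_generators
  have hfin := finite_of_isFFinite p e h
  obtain ⟨b, hb, hb'⟩ := (Module.Finite.fg_top (R := R)
    (M := FrobRoot R p e)).exists_minimal_generators
  have hsum : ∀ r : Fin _ → R, root R p e (∑ l, r l ^ p ^ e * (root R p e).symm (b l)) = ∑ l, r l • b l := by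
    intro r
    rw [map_sum]
    rfl
  refine Module.Free.of_basis (Module.Basis.mk (v := b) ?_ hb.ge)
  rw [Fintype.linearIndependent_iff]
  intro r hr l
  refine eq_zero_of_sum_pow_mul_eq_zero p e hx IsRegularLocalRing.spanFinrank_maximalIdeal.le
    (fun l => (root R p e).symm (b l)) (fun r hr => hb' r ?_) r ?_ l
  · rw [← root_mem_map_algebraMap, hsum] at hr
    rwa [Ideal.smul_top_eq_map]
  · rw [← (root R p e).map_eq_zero_iff, hsum, hr]

end FrobRoot

/-! ### Duality for `R^{1/q}` over `R` -/

open IsLocalRing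

theorem Module.Basis.mem_ideal_map_iff {R A ι : Type*} [CommRing R] [CommRing A] [Algebra R A]
    [Fintype ι] (b : Module.Basis ι R A) {I : Ideal R} {u : A} :
    u ∈ I.map (algebraMap R A) ↔ ∀ i, b.repr u i ∈ I := by
  constructor
  · intro hu i
    have hu' : u ∈ I • (⊤ : Submodule R A) := by rwa [Ideal.smul_top_eq_map]
    refine Submodule.smul_induction_on hu' (fun r hr y _ => ?_) (fun y z hy hz => ?_)
    · rw [map_smul, Finsupp.smul_apply, smul_eq_mul]
      exact I.mul_mem_right _ hr
    · rw [map_add, Finsupp.add_apply]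
      exact add_mem hy hz
  · intro h
    rw [← b.sum_repr u]
    refine sum_mem fun i _ => ?_
    rw [Algebra.smul_def]
    exact Ideal.mul_mem_right _ _ (Ideal.mem_map_of_mem _ (h i))

theorem LinearMap.apply_mem_of_mem_ideal_map {R A : Type*} [CommRing R] [CommRing A] [Algebra R A]
    (φ : A →ₗ[R] R) {I : Ideal R} {u : A} (hu : u ∈ I.map (algebraMap R A)) : φ u ∈ I := by
  have hu' : u ∈ I • (⊤ : Submodule R A) := by rwa [Ideal.smul_top_eq_map]
  refine Submodule.smul_induction_on hu' (fun r hr y _ => ?_) (fun y z hy hz => ?_)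
  · rw [map_smul, smul_eq_mul]
    exact I.mul_mem_right _ hr
  · rw [map_add]
    exact add_mem hy hz

section

variable {R A : Type*} [CommRing R] [IsLocalRing R] [CommRing A] [Algebra R A] [Module.Free R A]
  [Module.Finite R A]

theorem exists_linearMap_eq_one_of_notMem_map {s : A}
    (hs : s ∉ (maximalIdeal R).map (algebraMap R A)) : ∃ φ : A →ₗ[R] R, φ s = 1 := by
  let b := Module.Free.chooseBasis R A
  rw [b.mem_ideal_map_iff] at hs
  push Not at hs
  obtain ⟨i, hi⟩ := hs
  obtain ⟨v, hv⟩ := (show IsUnit (b.repr s i) by simpa using hi).exists_left_inv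
  exact ⟨v • b.coord i, by simpa using hv⟩

/-- If `A` is finite free over the local ring `R` and the closed fibre has simple socle (generated
by `s`), then `Hom_R(A, R)` is generated by one element over `A`. -/
theorem exists_generator_dual {s : A} (hs : s ∉ (maximalIdeal R).map (algebraMap R A))
    (hsoc : ∀ u ∉ (maximalIdeal R).map (algebraMap R A),
      ∃ v, u * v - s ∈ (maximalIdeal R).map (algebraMap R A)) :
    ∃ T : A →ₗ[R] R, (∀ φ : A →ₗ[R] R, ∃ u, ∀ y, φ y = T (u * y)) ∧
      ∀ (I : Ideal R) (u : A), (∀ y, T (u * y) ∈ I) → u ∈ I.map (algebraMap R A) := by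
  classical
  obtain ⟨T, hT⟩ := exists_linearMap_eq_one_of_notMem_map hs
  let b := Module.Free.chooseBasis R A
  -- The Gram matrix of the form `(y, z) ↦ T (y * z)`. Its invertibility gives both conclusions.
  let G : Matrix _ _ R := Matrix.of fun i j => T (b i * b j)
  have hG : ∀ (c : Module.Free.ChooseBasisIndex R A → R) i,
      (G.mulVec c) i = T ((∑ j, c j • b j) * b i) := by
    intro c i
    simp only [Matrix.mulVec, dotProduct, G, Matrix.of_apply, Finset.sum_mul, map_sum,
      smul_mul_assoc, map_smul, smul_eq_mul]
    exact Finset.sum_congr rfl fun j _ => by rw [mul_comm, mul_comm (b i)]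
  -- A kernel vector modulo `m` gives `u ∉ mA` with `T (u A) ⊆ m`. But some multiple of `u` is
  -- congruent to `s`, where `T` takes the value `1`.
  have hdet : IsUnit G.det := by
    by_contra hdet
    have h0 : (G.map (residue R)).det = 0 := by
      have h1 := RingHom.map_det (residue R) G
      rw [RingHom.mapMatrix_apply] at h1
      rw [← h1, residue_eq_zero_iff]
      simpa using hdet
    obtain ⟨v, hv0, hv⟩ := Matrix.exists_mulVec_eq_zero_iff.mpr h0
    choose c hc using fun i => residue_surjective (v i)
    have hcm : ∀ i, (G.mulVec c) i ∈ maximalIdeal R := by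
      intro i
      rw [← residue_eq_zero_iff, RingHom.map_mulVec]
      have : residue R ∘ c = v := funext hc
      rw [this, hv]
      rfl
    set u := ∑ j, c j • b j with hu
    have hTu : ∀ y, T (u * y) ∈ maximalIdeal R := by
      intro y
      rw [← b.sum_repr y, Finset.mul_sum, map_sum]
      refine sum_mem fun i _ => ?_
      rw [mul_smul_comm, map_smul, ← hG]
      exact Ideal.mul_mem_left _ _ (hcm i)
    have hum : u ∈ (maximalIdeal R).map (algebraMap R A) := by
      by_contra hum
      obtain ⟨v, hv⟩ := hsoc u hum
      have h1 := T.apply_mem_of_mem_ideal_map hv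
      rw [map_sub, hT] at h1
      have h2 := sub_mem (hTu v) h1
      rw [sub_sub_cancel] at h2
      exact (Ideal.ne_top_iff_one _).mp Ideal.IsPrime.ne_top' h2
    rw [b.mem_ideal_map_iff] at hum
    refine hv0 (funext fun i => ?_)
    have := hum i
    rw [hu, b.repr_sum_self] at this
    rw [← hc, Pi.zero_apply, residue_eq_zero_iff]
    exact this
  refine ⟨T, fun φ => ?_, fun I u hu => ?_⟩
  · refine ⟨∑ j, (G⁻¹.mulVec fun i => φ (b i)) j • b j, fun y => ?_⟩
    rw [← LinearMap.mulLeft_apply (R := R), ← LinearMap.comp_apply]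
    congr 1
    refine b.ext fun i => ?_
    rw [LinearMap.comp_apply, LinearMap.mulLeft_apply, ← hG, Matrix.mulVec_mulVec,
      Matrix.mul_nonsing_inv _ hdet, Matrix.one_mulVec]
  · rw [b.mem_ideal_map_iff]
    intro i
    have h1 : (fun i => b.repr u i) = G⁻¹.mulVec (G.mulVec fun i => b.repr u i) := by
      rw [Matrix.mulVec_mulVec, Matrix.nonsing_inv_mul _ hdet, Matrix.one_mulVec]
    rw [show b.repr u i = (fun i => b.repr u i) i from rfl, h1]
    refine sum_mem fun j _ => Ideal.mul_mem_left _ _ ?_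
    rw [hG, b.sum_repr]
    exact hu _

end

section

variable {R : Type*} [CommRing R] [IsRegularLocalRing R] (p e : ℕ) [ExpChar R p]

/-- In `R/m^[q]` the ideal `m` is nilpotent, so each nonzero ideal meets the socle; as the socle is
principal, its generator is a multiple of every nonzero element. -/
theorem IsRegularLocalRing.exists_socle_generator_frobenius :
    ∃ s, s ∉ (maximalIdeal R).map (iterateFrobenius R p e) ∧
      ∀ u ∉ (maximalIdeal R).map (iterateFrobenius R p e),
        ∃ v, u * v - s ∈ (maximalIdeal R).map (iterateFrobenius R p e) := by
  obtain ⟨x, hx, -⟩ := (IsNoetherian.noetherian (maximalIdeal R)).exists_minimal_generators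
  have hq : 0 < p ^ e := expChar_pow_pos R p e
  obtain ⟨s, hms, hs⟩ := exists_socle_generator hx
    IsRegularLocalRing.spanFinrank_maximalIdeal.le (fun _ => p ^ e) fun _ => hq
  have hmap : Ideal.span (Set.range fun j => x j ^ p ^ e) =
      (maximalIdeal R).map (iterateFrobenius R p e) := by
    rw [← Set.image_univ, ← Ideal.map_iterateFrobenius_span_image, Set.image_univ]
    exact congrArg _ hx
  rw [hmap] at hms hs
  set J := (maximalIdeal R).map (iterateFrobenius R p e) with hJ
  have hrad : maximalIdeal R ≤ J.radical := fun z hz =>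
    ⟨p ^ e, Ideal.mem_map_of_mem (iterateFrobenius R p e) hz⟩
  obtain ⟨N, hN⟩ := Ideal.exists_pow_le_of_le_radical_of_fg hrad (IsNoetherian.noetherian _)
  have key : ∀ u ∉ J, ∃ v w, w ∉ maximalIdeal R ∧ u * v ∉ J ∧ u * v - s * w ∈ J := by
    intro u hu
    classical
    -- The last power of `m` not carried into `J` by `u` yields a nonzero socle element `u * v`.
    have hex : ∃ k, ∀ v ∈ maximalIdeal R ^ k, u * v ∈ J :=
      ⟨N, fun v hv => J.mul_mem_left _ (hN hv)⟩
    obtain ⟨k, hk⟩ : ∃ k, Nat.find hex = k + 1 := by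
      refine Nat.exists_eq_succ_of_ne_zero fun h0 => hu ?_
      have := Nat.find_spec hex 1
      rw [h0] at this
      simpa using this
    have hmin := Nat.find_min hex (m := k) (by omega)
    push Not at hmin
    obtain ⟨v, hv, huv⟩ := hmin
    have hspec := Nat.find_spec hex
    rw [hk] at hspec
    obtain ⟨j, hj, w, hw, h⟩ := Submodule.mem_sup.mp (hs (u * v) fun z hz => by
      rw [mul_left_comm]
      exact hspec _ (by rw [pow_succ']; exact Ideal.mul_mem_mul hz hv))
    obtain ⟨c, rfl⟩ := Ideal.mem_span_singleton.mp hw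
    refine ⟨v, c, fun hc => huv ?_, huv, by rwa [← h, add_sub_cancel_right]⟩
    rw [← h, mul_comm s c]
    exact add_mem hj (hms c hc)
  refine ⟨s, fun hsJ => ?_, fun u hu => ?_⟩
  · obtain ⟨v, w, -, huv, h⟩ := key 1 fun h1 => (Ideal.ne_top_iff_one _).mp
      (Ideal.IsPrime.ne_top' (I := maximalIdeal R))
      (Ideal.map_le_iff_le_comap.mpr (fun z hz => Ideal.pow_mem_of_mem _ hz _ hq) h1)
    exact huv (by simpa using add_mem h (J.mul_mem_right w hsJ))
  · obtain ⟨v, w, hw, -, h⟩ := key u hu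
    obtain ⟨w', hw'⟩ := (show IsUnit w by simpa using hw).exists_left_inv
    refine ⟨v * w', ?_⟩
    have : u * (v * w') - s = w' * (u * v - s * w) := by linear_combination s * hw'
    rw [this]
    exact J.mul_mem_left _ h

/-- `Hom_R(R^{1/q}, R)` is generated by one element over `R^{1/q}`. -/
theorem IsRegularLocalRing.exists_frobenius_trace (h : IsFFinite R p) :
    ∃ T : FrobRoot R p e →ₗ[R] R, (∀ φ : FrobRoot R p e →ₗ[R] R, ∃ u, ∀ y, φ y = T (u * y)) ∧
      ∀ (I : Ideal R) (u : FrobRoot R p e), (∀ y, T (u * y) ∈ I) →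
        u ∈ I.map (algebraMap R (FrobRoot R p e)) := by
  have := FrobRoot.finite_of_isFFinite p e h
  have := FrobRoot.free_of_isFFinite p e h
  obtain ⟨s, hs, hsoc⟩ := IsRegularLocalRing.exists_socle_generator_frobenius (R := R) p e
  exact exists_generator_dual (s := FrobRoot.root R p e s) hs hsoc

end

/-! ### Splittings and Fedder's criterion -/

section

variable {R : Type*} [CommRing R] (p : ℕ) (e : ℕ) [ExpChar R p]

theorem rootSplits_iff {d : R} :
    RootSplits p e d ↔ ∃ φ : FrobRoot R p e →ₗ[R] R, φ (FrobRoot.root R p e d) = 1 := by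
  refine exists_congr fun φ => ⟨fun h => ?_, fun h => ?_⟩
  · have := LinearMap.congr_fun h 1
    simpa using this
  · refine LinearMap.ext_ring ?_
    simpa using h

theorem RootSplits.of_mul {c d : R} (h : RootSplits p e (c * d)) : RootSplits p e d := by
  rw [rootSplits_iff] at h ⊢
  obtain ⟨φ, hφ⟩ := h
  refine ⟨φ.comp (LinearMap.mulLeft R (FrobRoot.root R p e c)), ?_⟩
  simpa using hφ

/-- Composition of splittings. -/
theorem RootSplits.comp {e' : ℕ} {x y : R} (hx : RootSplits p e x) (hy : RootSplits p e' y) :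
    RootSplits p (e + e') (x ^ p ^ e' * y) := by
  rw [rootSplits_iff] at hx hy ⊢
  obtain ⟨φ, hφ⟩ := hx
  obtain ⟨ψ, hψ⟩ := hy
  have hψs : ∀ r z : R, ψ (FrobRoot.root R p e' (r ^ p ^ e' * z)) =
      r * ψ (FrobRoot.root R p e' z) := fun r z => ψ.map_smul r _
  have hφs : ∀ r z : R, φ (FrobRoot.root R p e (r ^ p ^ e * z)) =
      r * φ (FrobRoot.root R p e z) := fun r z => φ.map_smul r _
  refine ⟨{ toFun := fun z => φ (FrobRoot.root R p e (ψ (FrobRoot.root R p e'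
              ((FrobRoot.root R p (e + e')).symm z))))
            map_add' := fun a b => by simp only [map_add]
            map_smul' := fun r z => ?_ }, ?_⟩
  · obtain ⟨z, rfl⟩ := (FrobRoot.root R p (e + e')).surjective z
    rw [FrobRoot.smul_root, RingEquiv.symm_apply_apply, RingEquiv.symm_apply_apply, pow_add,
      pow_mul, hψs, hφs]
    rfl
  · rw [LinearMap.coe_mk, AddHom.coe_mk, RingEquiv.symm_apply_apply, hψs, hψ, mul_one, hφ]

theorem RootSplits.notMem_map [IsLocalRing R] {d : R} (h : RootSplits p e d) :
    d ∉ (maximalIdeal R).map (iterateFrobenius R p e) := by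
  rw [rootSplits_iff] at h
  obtain ⟨φ, hφ⟩ := h
  intro hd
  have := φ.apply_mem_of_mem_ideal_map (I := maximalIdeal R) (u := FrobRoot.root R p e d) hd
  rw [hφ] at this
  exact (Ideal.ne_top_iff_one _).mp Ideal.IsPrime.ne_top' this

end

section

variable {R : Type*} [CommRing R] [IsRegularLocalRing R] (p : ℕ) (e : ℕ)

theorem rootSplits_of_notMem_map [ExpChar R p] (h : IsFFinite R p) {d : R}
    (hd : d ∉ (maximalIdeal R).map (iterateFrobenius R p e)) : RootSplits p e d := by
  have := FrobRoot.finite_of_isFFinite p e h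
  have := FrobRoot.free_of_isFFinite p e h
  rw [rootSplits_iff]
  exact exists_linearMap_eq_one_of_notMem_map (s := FrobRoot.root R p e d) hd

/-- **Fedder's criterion**, sufficiency. -/
theorem rootSplits_quotient_of_notMem_map [ExpChar R p] (h : IsFFinite R p) {I : Ideal R}
    [ExpChar (R ⧸ I) p] {u d : R} (hu : ∀ x ∈ I, u * x ∈ I.map (iterateFrobenius R p e))
    (hd : u * d ∉ (maximalIdeal R).map (iterateFrobenius R p e)) :
    RootSplits p e (Ideal.Quotient.mk I d) := by
  obtain ⟨φ, hφ⟩ := (rootSplits_iff p e).mp (rootSplits_of_notMem_map p e h hd)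
  rw [rootSplits_iff]
  -- Since `u I ⊆ I^[q]` and `φ` maps `I^[q]` into `I`, the map `x ↦ φ (u x)` descends to the
  -- quotient, where it sends `d` to `1`.
  let f : R →+ R ⧸ I := (Ideal.Quotient.mk I).toAddMonoidHom.comp (φ.toAddMonoidHom.comp
    ((FrobRoot.root R p e).toAddMonoidHom.comp (AddMonoidHom.mulLeft u)))
  have hf : ∀ x, f x = Ideal.Quotient.mk I (φ (FrobRoot.root R p e (u * x))) := fun _ => rfl
  have hfI : ∀ x ∈ I, f x = 0 := by
    intro x hx
    rw [hf, Ideal.Quotient.eq_zero_iff_mem]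
    exact φ.apply_mem_of_mem_ideal_map (u := FrobRoot.root R p e (u * x)) (hu x hx)
  let g : R ⧸ I →+ R ⧸ I := QuotientAddGroup.lift I.toAddSubgroup f hfI
  have hg : ∀ x, g (Ideal.Quotient.mk I x) = f x := fun _ => rfl
  refine ⟨{ toFun := fun z => g ((FrobRoot.root (R ⧸ I) p e).symm z)
            map_add' := fun a b => by simp only [map_add]
            map_smul' := fun r z => ?_ }, ?_⟩
  · obtain ⟨z, rfl⟩ := (FrobRoot.root (R ⧸ I) p e).surjective z
    obtain ⟨z, rfl⟩ := Ideal.Quotient.mk_surjective z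
    obtain ⟨r, rfl⟩ := Ideal.Quotient.mk_surjective r
    rw [FrobRoot.smul_root, RingEquiv.symm_apply_apply, RingEquiv.symm_apply_apply, ← map_pow,
      ← map_mul, hg, hg, hf, hf, mul_left_comm, ← FrobRoot.smul_root, map_smul, smul_eq_mul,
      map_mul]
    rfl
  · rw [LinearMap.coe_mk, AddHom.coe_mk, RingEquiv.symm_apply_apply, hg, hf, hφ, map_one]

/-- **Fedder's criterion**, necessity. -/
theorem RootSplits.exists_notMem_map [ExpChar R p] (h : IsFFinite R p) {I : Ideal R} (hI : I ≠ ⊤)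
    [ExpChar (R ⧸ I) p] {d : R} (hd : RootSplits p e (Ideal.Quotient.mk I d)) :
    ∃ u, (∀ x ∈ I, u * x ∈ I.map (iterateFrobenius R p e)) ∧
      u * d ∉ (maximalIdeal R).map (iterateFrobenius R p e) := by
  have := FrobRoot.finite_of_isFFinite p e h
  have := FrobRoot.free_of_isFFinite p e h
  obtain ⟨ψ, hψ⟩ := (rootSplits_iff p e).mp hd
  obtain ⟨T, hT, hTI⟩ := IsRegularLocalRing.exists_frobenius_trace p e h
  let b := Module.Free.chooseBasis R (FrobRoot R p e)
  let ρ : FrobRoot R p e → R ⧸ I := fun z =>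
    ψ (FrobRoot.root (R ⧸ I) p e (Ideal.Quotient.mk I ((FrobRoot.root R p e).symm z)))
  have hρs : ∀ (r : R) z, ρ (r • z) = Ideal.Quotient.mk I r * ρ z := by
    intro r z
    obtain ⟨z, rfl⟩ := (FrobRoot.root R p e).surjective z
    simp only [ρ, FrobRoot.smul_root, RingEquiv.symm_apply_apply, map_mul, map_pow]
    rw [← map_pow, ← map_mul, ← FrobRoot.smul_root, map_smul, smul_eq_mul]
  choose c hc using fun i => Ideal.Quotient.mk_surjective (ρ (b i))
  -- Freeness of `R^{1/q}` lifts the splitting on `R/I` to `φ`. Writing `φ = T (u · )`, the fact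
  -- that `φ` sends `I` into `I` becomes `u I ⊆ I^[q]`.
  let φ : FrobRoot R p e →ₗ[R] R := b.constr R c
  have hφ : ∀ z, Ideal.Quotient.mk I (φ z) = ρ z := by
    intro z
    have hρ : ρ z = ∑ i, Ideal.Quotient.mk I (b.repr z i) * ρ (b i) := by
      conv_lhs => rw [← b.sum_repr z]
      simp only [← hρs]
      simp only [ρ, map_sum]
    rw [hρ, show φ z = _ from b.constr_apply_fintype R c z, map_sum]
    refine Finset.sum_congr rfl fun i _ => ?_
    rw [smul_eq_mul, map_mul, hc]
    rfl
  obtain ⟨u, hu⟩ := hT φ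
  obtain ⟨u, rfl⟩ := (FrobRoot.root R p e).surjective u
  refine ⟨u, fun x hx => ?_, fun hud => ?_⟩
  · rw [← FrobRoot.root_mem_map_algebraMap]
    refine hTI I _ fun y => ?_
    obtain ⟨y, rfl⟩ := (FrobRoot.root R p e).surjective y
    rw [map_mul (FrobRoot.root R p e), mul_assoc, ← hu, ← Ideal.Quotient.eq_zero_iff_mem, hφ, ← map_mul]
    simp only [ρ, RingEquiv.symm_apply_apply]
    rw [Ideal.Quotient.eq_zero_iff_mem.mpr (I.mul_mem_right y hx), map_zero, map_zero]
  · have h1 : φ (FrobRoot.root R p e d) ∈ maximalIdeal R := by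
      rw [hu, ← map_mul]
      exact T.apply_mem_of_mem_ideal_map (u := FrobRoot.root R p e (u * d)) hud
    have h2 : φ (FrobRoot.root R p e d) - 1 ∈ I := by
      rw [← Ideal.Quotient.eq_zero_iff_mem, map_sub, hφ, map_one]
      simp only [ρ, RingEquiv.symm_apply_apply]
      rw [hψ, sub_self]
    have h3 := sub_mem h1 (le_maximalIdeal hI h2)
    rw [sub_sub_cancel] at h3
    exact (Ideal.ne_top_iff_one _).mp Ideal.IsPrime.ne_top' h3

end

/-! ### The colon ideal lies in `I ^ (q - 1)` -/

section

variable {R : Type*} [CommRing R] (p e : ℕ) [ExpChar R p]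

/-- Flatness of Frobenius, for colon ideals. -/
theorem FrobRoot.mem_map_comap_mulLeft [Module.Free R (FrobRoot R p e)]
    [Module.Finite R (FrobRoot R p e)] {J : Ideal R} {z y : R}
    (h : z ^ p ^ e * y ∈ J.map (iterateFrobenius R p e)) :
    y ∈ Ideal.map (iterateFrobenius R p e) (Submodule.comap (LinearMap.mulLeft R z) J) := by
  let b := Module.Free.chooseBasis R (FrobRoot R p e)
  rw [← root_mem_map_algebraMap, b.mem_ideal_map_iff] at h ⊢
  intro i
  have := h i
  rw [← smul_root, map_smul] at this
  exact this

/-- Iterate: `u` carries `I` into `I^[q]`, its Frobenius power `u ^ q` carries `I^[q]` into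
`I^[q²]`, and so on; the exponents add up to a geometric sum. -/
theorem Ideal.pow_mul_mem_of_mul_mem {I : Ideal R} {u f : R} (hf : f ∈ I)
    (hu : ∀ x ∈ I, u * x ∈ I.map (iterateFrobenius R p e)) (n : ℕ) :
    u ^ (∑ i ∈ Finset.range n, (p ^ e) ^ i) * f ∈ I.map (iterateFrobenius R p (e * n)) := by
  suffices key : ∀ (n : ℕ), ∀ f ∈ I, u ^ (∑ i ∈ Finset.range n, (p ^ e) ^ i) * f ∈
      I.map (iterateFrobenius R p (e * n)) from key n f hf
  intro n
  induction n with
  | zero =>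
    intro f hf
    simpa [iterateFrobenius_def] using Ideal.mem_map_of_mem (iterateFrobenius R p 0) hf
  | succ n ih =>
    intro f hf
    have hexp : ∑ i ∈ Finset.range (n + 1), (p ^ e) ^ i =
        p ^ e * (∑ i ∈ Finset.range n, (p ^ e) ^ i) + 1 := by
      rw [Finset.sum_range_succ', Finset.mul_sum, pow_zero]
      simp only [pow_succ']
    rw [hexp, pow_succ, mul_assoc]
    have hmap : I.map (iterateFrobenius R p (e * (n + 1))) =
        (I.map (iterateFrobenius R p (e * n))).map (iterateFrobenius R p e) := by
      rw [Ideal.map_map]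
      congr 1
      ext r
      simp [iterateFrobenius_def, ← pow_mul, ← pow_add, mul_add]
    rw [hmap]
    set K := I.map (iterateFrobenius R p (e * n))
    refine Submodule.span_induction (p := fun w _ => u ^ (p ^ e *
      ∑ i ∈ Finset.range n, (p ^ e) ^ i) * w ∈ K.map (iterateFrobenius R p e)) ?_ ?_ ?_ ?_
      (hu f hf)
    · rintro _ ⟨g, hg, rfl⟩
      have h1 := Ideal.mem_map_of_mem (iterateFrobenius R p e) (ih g hg)
      rwa [map_mul, iterateFrobenius_def, ← pow_mul, mul_comm _ (p ^ e)] at h1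
    · simp
    · intro x y _ _ hx hy
      rw [mul_add]
      exact add_mem hx hy
    · intro a x _ hx
      rw [smul_eq_mul, mul_left_comm]
      exact Ideal.mul_mem_left _ _ hx

/-- In a regular local ring, `(I^[q] : I) ≤ I ^ (q - 1)`. -/
theorem IsRegularLocalRing.mem_pow_of_mul_mem_map_iterateFrobenius [IsRegularLocalRing R]
    (hp : 1 < p) (h : IsFFinite R p) {I : Ideal R} (hI : I ≠ ⊥) {u : R}
    (hu : ∀ x ∈ I, u * x ∈ I.map (iterateFrobenius R p e)) : u ∈ I ^ (p ^ e - 1) := by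
  have := isDomain_of_isRegularLocalRing R
  obtain ⟨f, hf, hf0⟩ := Submodule.exists_mem_ne_zero_of_ne_bot hI
  rcases Nat.eq_zero_or_pos e with rfl | he
  · simp
  by_contra hcon
  set q := p ^ e with hq
  have hq1 : 1 < q := Nat.one_lt_pow he.ne' hp
  refine pow_ne_zero (q - 1) hf0 ?_
  rw [← Ideal.mem_bot, ← Ideal.iInf_pow_eq_bot_of_isLocalRing (maximalIdeal R)
    Ideal.IsPrime.ne_top', Submodule.mem_iInf]
  intro n
  have := FrobRoot.finite_of_isFFinite p (e * n) h
  have := FrobRoot.free_of_isFFinite p (e * n) h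
  -- The `(q - 1)`-st power makes the geometric sum `q ^ n - 1`; one more factor `u` gives an exact
  -- `q ^ n`-th power, to which flatness of Frobenius applies.
  have h1 : u ^ p ^ (e * n) * f ^ (q - 1) ∈
      (I ^ (q - 1)).map (iterateFrobenius R p (e * n)) := by
    have h2 := Ideal.pow_mem_pow (Ideal.pow_mul_mem_of_mul_mem p e hf hu n) (q - 1)
    have h3 : p ^ (e * n) = (∑ i ∈ Finset.range n, q ^ i) * (q - 1) + 1 := by
      rw [Nat.geomSum_eq hq1, Nat.div_mul_cancel (Nat.sub_one_dvd_pow_sub_one q n), pow_mul,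
        Nat.sub_add_cancel (Nat.one_le_pow _ _ (by omega))]
    rw [Ideal.map_pow, h3, pow_succ, mul_assoc, pow_mul, mul_left_comm, ← mul_pow]
    exact Ideal.mul_mem_left _ _ h2
  have h4 := FrobRoot.mem_map_comap_mulLeft p (e * n) h1
  have h5 : Submodule.comap (LinearMap.mulLeft R u) (I ^ (q - 1)) ≤ maximalIdeal R := by
    refine le_maximalIdeal fun htop => hcon ?_
    have : (1 : R) ∈ Submodule.comap (LinearMap.mulLeft R u) (I ^ (q - 1)) :=
      htop ▸ Submodule.mem_top
    simpa using this
  have h6 : (maximalIdeal R).map (iterateFrobenius R p (e * n)) ≤ maximalIdeal R ^ n := by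
    rw [Ideal.map_le_iff_le_comap]
    intro z hz
    rw [Ideal.mem_comap, iterateFrobenius_def]
    refine Ideal.pow_le_pow_right ?_ (Ideal.pow_mem_pow hz _)
    calc n ≤ e * n := Nat.le_mul_of_pos_left _ he
      _ ≤ p ^ (e * n) := (Nat.lt_pow_self hp).le
  exact h6 (Ideal.map_mono h5 h4)

end

/-! ### Lech independence and length estimates -/

section

variable {A : Type*} [CommRing A]

theorem Ideal.span_range_update {r : ℕ} (y : Fin r → A) (j : Fin r) (c : A) :
    span (Set.range (Function.update y j c)) =
      span (Set.range (Function.update y j 0)) ⊔ span {c} := by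
  refine le_antisymm (span_le.mpr ?_) (sup_le (span_le.mpr ?_) (span_le.mpr ?_))
  · rintro _ ⟨i, rfl⟩
    by_cases hi : i = j
    · subst hi
      rw [Function.update_self]
      exact Submodule.mem_sup_right (mem_span_singleton_self c)
    · refine Submodule.mem_sup_left (subset_span ⟨i, ?_⟩)
      simp [hi]
  · rintro _ ⟨i, rfl⟩
    by_cases hi : i = j
    · subst hi
      simp
    · exact subset_span ⟨i, by simp [hi]⟩
  · rintro _ rfl
    exact subset_span ⟨j, by simp⟩

/-- Lech independence: all relations have coefficients in the ideal generated by the sequence. -/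
def LechIndependent {r : ℕ} (y : Fin r → A) : Prop :=
  ∀ a : Fin r → A, ∑ i, a i * y i = 0 → ∀ i, a i ∈ Ideal.span (Set.range y)

namespace LechIndependent

variable {r : ℕ} {y : Fin r → A} {j : Fin r} {f g : A}

/-- If `g a = k + f g c`, multiplying by `f` gives `(a - f c) (f g) = f k`, a relation whose `j`-th
coefficient is `a - f c`. -/
theorem mem_of_mul_mem (h : LechIndependent (Function.update y j (f * g))) {a : A}
    (ha : g * a ∈ Ideal.span (Set.range (Function.update y j (f * g)))) :
    a ∈ Ideal.span (Set.range (Function.update y j f)) := by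
  rw [Ideal.span_range_update] at ha
  obtain ⟨k, hk, w, hw, hkw⟩ := Submodule.mem_sup.mp ha
  obtain ⟨c, rfl⟩ := Ideal.mem_span_singleton.mp hw
  obtain ⟨b, hb⟩ := Ideal.mem_span_range_iff_exists_fun.mp hk
  have hsum : ∀ b : Fin r → A, ∀ w, ∑ i, b i * Function.update y j w i =
      b j * w + ∑ i ∈ Finset.univ.erase j, b i * y i := by
    intro b w
    rw [← Finset.add_sum_erase _ _ (Finset.mem_univ j), Function.update_self]
    congr 1
    refine Finset.sum_congr rfl fun i hi => ?_
    rw [Function.update_of_ne (Finset.ne_of_mem_erase hi)]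
  have h1 := h (Function.update (fun i => -(f * b i)) j (a - f * c)) ?_ j
  · rw [Function.update_self, Ideal.span_range_update] at h1
    rw [Ideal.span_range_update]
    have h2 : a = (a - f * c) + f * c := by ring
    rw [h2]
    have h3 := sup_le_sup_left (Ideal.span_singleton_le_span_singleton.mpr (dvd_mul_right f g))
      (Ideal.span (Set.range (Function.update y j 0)))
    exact add_mem (h3 h1) (Submodule.mem_sup_right
      (Ideal.mul_mem_right _ _ (Ideal.mem_span_singleton_self f)))
  · rw [hsum, Function.update_self]
    have h3 : ∑ i ∈ Finset.univ.erase j, Function.update (fun i => -(f * b i)) j (a - f * c) i *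
        y i = -(f * k) := by
      rw [← hb, hsum, mul_zero, zero_add, Finset.mul_sum, ← Finset.sum_neg_distrib]
      refine Finset.sum_congr rfl fun i hi => ?_
      rw [Function.update_of_ne (Finset.ne_of_mem_erase hi)]
      ring
    rw [h3]
    linear_combination -f * hkw

/-- Multiplying a relation by `g` leaves the `j`-th coefficient alone, with entry `f * g`, and
multiplies the others by `g`, which `mem_of_mul_mem` then removes. -/
theorem update_of_mul (h : LechIndependent (Function.update y j (f * g))) :
    LechIndependent (Function.update y j f) := by
  intro a ha i
  have h1 : ∑ i, Function.update (fun i => g * a i) j (a j) i *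
      Function.update y j (f * g) i = 0 := by
    rw [← mul_zero g, ← ha, Finset.mul_sum]
    refine Finset.sum_congr rfl fun i _ => ?_
    by_cases hi : i = j
    · subst hi
      simp only [Function.update_self]
      ring
    · simp only [Function.update_of_ne hi]
      ring
  have h2 := h _ h1 i
  by_cases hi : i = j
  · subst hi
    rw [Function.update_self] at h2
    refine h.mem_of_mul_mem (Ideal.mul_mem_left _ _ h2)
  · rw [Function.update_of_ne hi] at h2
    exact h.mem_of_mul_mem h2

end LechIndependent

theorem Ideal.exact_quotient_mul (K : Ideal A) (f g : A) (hle : K ⊔ span {f} ≤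
      Submodule.comap (LinearMap.mulLeft A g) (K ⊔ span {f * g}))
    (hle' : K ⊔ span {f * g} ≤ K ⊔ span {g}) :
    Function.Exact (Submodule.mapQ (K ⊔ span {f}) (K ⊔ span {f * g}) (LinearMap.mulLeft A g) hle)
      (Submodule.factor hle') := by
  intro x
  obtain ⟨x, rfl⟩ := Submodule.Quotient.mk_surjective _ x
  rw [show Submodule.factor hle' (Submodule.Quotient.mk x) = Submodule.Quotient.mk x from rfl,
    Submodule.Quotient.mk_eq_zero]
  constructor
  · intro hx
    obtain ⟨k, hk, w, hw, rfl⟩ := Submodule.mem_sup.mp hx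
    obtain ⟨c, rfl⟩ := mem_span_singleton.mp hw
    refine ⟨Submodule.Quotient.mk c, ?_⟩
    rw [Submodule.mapQ_apply, Submodule.Quotient.eq, LinearMap.mulLeft_apply]
    refine Submodule.mem_sup_left ?_
    rw [sub_add_cancel_right]
    exact neg_mem hk
  · rintro ⟨c, hc⟩
    obtain ⟨c, rfl⟩ := Submodule.Quotient.mk_surjective _ c
    rw [Submodule.mapQ_apply, Submodule.Quotient.eq, LinearMap.mulLeft_apply] at hc
    have := sub_mem (Submodule.mem_sup_right (mul_mem_right c _ (mem_span_singleton_self g)))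
      (hle' hc)
    rwa [sub_sub_cancel] at this

theorem Ideal.sup_span_le_comap_mulLeft (K : Ideal A) (f g : A) :
    K ⊔ span {f} ≤ Submodule.comap (LinearMap.mulLeft A g) (K ⊔ span {f * g}) := by
  refine sup_le (fun k hk => ?_) (span_le.mpr ?_)
  · exact Submodule.mem_sup_left (K.mul_mem_left g hk)
  · rintro _ rfl
    refine Submodule.mem_sup_right ?_
    rw [LinearMap.mulLeft_apply, mul_comm]
    exact mem_span_singleton_self _

theorem Ideal.sup_span_mul_le (K : Ideal A) (f g : A) :
    K ⊔ span {f * g} ≤ K ⊔ span {g} :=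
  sup_le_sup_left (span_singleton_le_span_singleton.mpr (dvd_mul_left g f)) K

theorem Ideal.length_quotient_sup_span_mul_le (K : Ideal A) (f g : A) :
    Module.length A (A ⧸ K ⊔ span {f * g}) ≤
      Module.length A (A ⧸ K ⊔ span {f}) + Module.length A (A ⧸ K ⊔ span {g}) := by
  have hex := exact_quotient_mul K f g (sup_span_le_comap_mulLeft K f g) (sup_span_mul_le K f g)
  set φ := Submodule.mapQ (K ⊔ span {f}) (K ⊔ span {f * g}) (LinearMap.mulLeft A g)
    (sup_span_le_comap_mulLeft K f g)
  rw [Module.length_eq_add_of_exact (LinearMap.range φ).subtype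
    (Submodule.factor (sup_span_mul_le K f g)) (Submodule.subtype_injective _)
    (Submodule.factor_surjective _) ?_]
  · gcongr
    exact Module.length_le_of_surjective φ.rangeRestrict φ.surjective_rangeRestrict
  · intro x
    rw [hex x]
    simp

/-- The colon hypothesis is exactly injectivity of multiplication by `g` from `A/(K + (f))` to `A/(K
+ (f g))`. -/
theorem Ideal.length_quotient_sup_span_mul_eq {K : Ideal A} {f g : A}
    (h : ∀ a, g * a ∈ K ⊔ span {f * g} → a ∈ K ⊔ span {f}) :
    Module.length A (A ⧸ K ⊔ span {f * g}) =
      Module.length A (A ⧸ K ⊔ span {f}) + Module.length A (A ⧸ K ⊔ span {g}) := by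
  refine Module.length_eq_add_of_exact _ _ ?_ (Submodule.factor_surjective _)
    (exact_quotient_mul K f g (sup_span_le_comap_mulLeft K f g) (sup_span_mul_le K f g))
  rw [← LinearMap.ker_eq_bot, LinearMap.ker_eq_bot']
  intro x hx
  obtain ⟨x, rfl⟩ := Submodule.Quotient.mk_surjective _ x
  rw [Submodule.mapQ_apply, Submodule.Quotient.mk_eq_zero, LinearMap.mulLeft_apply] at hx
  rw [Submodule.Quotient.mk_eq_zero]
  exact h x hx

theorem Function.pow_update {r : ℕ} (x : Fin r → A) (a : Fin r → ℕ) (j : Fin r) (c : ℕ) :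
    (fun i => x i ^ Function.update a j c i) =
      Function.update (fun i => x i ^ a i) j (x j ^ c) := by
  funext i
  by_cases hi : i = j
  · subst hi; simp
  · simp [hi]

theorem exists_eq_update_add_one {r : ℕ} {a : Fin r → ℕ} (ha : ∀ i, 0 < a i)
    (h : ¬ ∀ i, a i = 1) : ∃ j c, 0 < c ∧ a = Function.update a j (c + 1) := by
  push Not at h
  obtain ⟨j, hj⟩ := h
  obtain ⟨c, hc⟩ := Nat.exists_eq_add_one.mpr (ha j)
  exact ⟨j, c, by omega, by rw [← hc, Function.update_eq_self]⟩

theorem sum_update_lt {r : ℕ} {a : Fin r → ℕ} {j : Fin r} {c d : ℕ} (hcd : c < d)  :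
    ∑ i, Function.update a j c i < ∑ i, Function.update a j d i := by
  rw [Finset.sum_update_of_mem (Finset.mem_univ j), Finset.sum_update_of_mem (Finset.mem_univ j)]
  omega

theorem prod_update_add_one {r : ℕ} (a : Fin r → ℕ) (j : Fin r) (c : ℕ) :
    ∏ i, Function.update a j (c + 1) i =
      ∏ i, Function.update a j c i + ∏ i, Function.update a j 1 i := by
  simp only [Finset.prod_update_of_mem (Finset.mem_univ j)]
  ring

theorem update_pos {r : ℕ} {a : Fin r → ℕ} (ha : ∀ i, 0 < a i) (j : Fin r) {c : ℕ} (hc : 0 < c)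
    (i : Fin r) : 0 < Function.update a j c i := by
  by_cases hi : i = j
  · subst hi; simpa
  · simpa [hi] using ha i

/-- Split `x ^ (c + 1)` as `x ^ c * x`: lengths are subadditive in each exponent. -/
theorem length_quotient_span_pow_le {r : ℕ} (x : Fin r → A) (a : Fin r → ℕ) (ha : ∀ i, 0 < a i) :
    Module.length A (A ⧸ Ideal.span (Set.range fun i => x i ^ a i)) ≤
      (∏ i, a i : ℕ) * Module.length A (A ⧸ Ideal.span (Set.range x)) := by
  induction hn : ∑ i, a i using Nat.strong_induction_on generalizing a with
  | _ n ih =>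
    by_cases h1 : ∀ i, a i = 1
    · obtain rfl : a = fun _ => 1 := funext h1
      rw [show (fun i => x i ^ 1) = x from funext fun i => pow_one _]
      simp
    · obtain ⟨j, c, hc, hac⟩ := exists_eq_update_add_one ha h1
      have hlt := sum_update_lt (a := a) (j := j) (Nat.lt_add_one c)
      have hlt' := sum_update_lt (a := a) (j := j) (show 1 < c + 1 by omega)
      rw [← hac, hn] at hlt hlt'
      have i1 := ih _ hlt (Function.update a j c) (update_pos ha j hc) rfl
      have i2 := ih _ hlt' (Function.update a j 1) (update_pos ha j one_pos) rfl
      rw [hac, prod_update_add_one, Nat.cast_add, add_mul]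
      refine le_trans ?_ (add_le_add i1 i2)
      rw [Function.pow_update x a j (c + 1), Function.pow_update x a j c,
        Function.pow_update x a j 1, Ideal.span_range_update _ j (x j ^ (c + 1)),
        Ideal.span_range_update _ j (x j ^ c), Ideal.span_range_update _ j (x j ^ 1)]
      have := Ideal.length_quotient_sup_span_mul_le (Ideal.span (Set.range
        (Function.update (fun i => x i ^ a i) j 0))) (x j ^ c) (x j ^ 1)
      rwa [← pow_add] at this

/-- For a Lech independent sequence the same splitting is additive, and both smaller sequences are
again Lech independent. -/
theorem LechIndependent.prod_le_length {r : ℕ} {x : Fin r → A}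
    (hx : Ideal.span (Set.range x) ≠ ⊤) (a : Fin r → ℕ) (ha : ∀ i, 0 < a i)
    (h : LechIndependent fun i => x i ^ a i) :
    (∏ i, a i : ℕ) ≤ Module.length A (A ⧸ Ideal.span (Set.range fun i => x i ^ a i)) := by
  induction hn : ∑ i, a i using Nat.strong_induction_on generalizing a with
  | _ n ih =>
    by_cases h1 : ∀ i, a i = 1
    · obtain rfl : a = fun _ => 1 := funext h1
      rw [show (fun i => x i ^ 1) = x from funext fun i => pow_one _, Finset.prod_const_one,
        Nat.cast_one]
      have : Nontrivial (A ⧸ Ideal.span (Set.range x)) := Ideal.Quotient.nontrivial_iff.mpr hx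
      exact Order.one_le_iff_pos.mpr Module.length_pos
    · obtain ⟨j, c, hc, hac⟩ := exists_eq_update_add_one ha h1
      have hlt := sum_update_lt (a := a) (j := j) (Nat.lt_add_one c)
      have hlt' := sum_update_lt (a := a) (j := j) (show 1 < c + 1 by omega)
      rw [← hac, hn] at hlt hlt'
      rw [hac, Function.pow_update, pow_add, pow_one] at h
      have i1 := ih _ hlt (Function.update a j c) (update_pos ha j hc)
        (by rw [Function.pow_update]; exact h.update_of_mul) rfl
      have i2 := ih _ hlt' (Function.update a j 1) (update_pos ha j one_pos)
        (by rw [Function.pow_update, pow_one]; rw [mul_comm] at h; exact h.update_of_mul) rfl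
      rw [hac, prod_update_add_one, Nat.cast_add]
      refine le_trans (add_le_add i1 i2) ?_
      rw [Function.pow_update x a j (c + 1), Function.pow_update x a j c,
        Function.pow_update x a j 1, Ideal.span_range_update _ j (x j ^ (c + 1)),
        Ideal.span_range_update _ j (x j ^ c), Ideal.span_range_update _ j (x j ^ 1)]
      have hmem : ∀ a', x j * a' ∈ Ideal.span (Set.range
        (Function.update (fun i => x i ^ a i) j 0)) ⊔ Ideal.span {x j ^ c * x j} →
          a' ∈ Ideal.span (Set.range
            (Function.update (fun i => x i ^ a i) j 0)) ⊔ Ideal.span {x j ^ c} := by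
        intro a' ha'
        rw [← Ideal.span_range_update] at ha' ⊢
        exact h.mem_of_mul_mem ha'
      rw [pow_add, pow_one, Ideal.length_quotient_sup_span_mul_eq hmem]

end

/-! ### Flat Frobenius forces regularity -/

section

/-- The equational form of flatness of the `e`-fold Frobenius. -/
def IsFrobeniusFlat (R : Type*) [CommRing R] (p e : ℕ) : Prop :=
  ∀ (r : ℕ) (x a : Fin r → R), ∑ i, a i * x i ^ p ^ e = 0 →
    ∃ (N : ℕ) (b : Fin r → Fin N → R) (c : Fin N → R),
      (∀ i, a i = ∑ j, b i j ^ p ^ e * c j) ∧ ∀ j, ∑ i, b i j * x i = 0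

theorem isFrobeniusFlat_of_free (R : Type*) [CommRing R] [Nontrivial R] (p e : ℕ) [ExpChar R p]
    [Module.Free R (FrobRoot R p e)] [Module.Finite R (FrobRoot R p e)] :
    IsFrobeniusFlat R p e := by
  intro r x a h
  let b := Module.finBasis R (FrobRoot R p e)
  refine ⟨_, fun i j => b.repr (FrobRoot.root R p e (a i)) j,
    fun j => (FrobRoot.root R p e).symm (b j), fun i => ?_, fun j => ?_⟩
  · apply (FrobRoot.root R p e).injective
    conv_lhs => rw [← b.sum_repr (FrobRoot.root R p e (a i))]
    rw [map_sum]
    rfl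
  · have h1 : ∑ i, x i • FrobRoot.root R p e (a i) = 0 := by
      rw [← map_zero (FrobRoot.root R p e), ← h, map_sum]
      exact Finset.sum_congr rfl fun i _ => by rw [FrobRoot.smul_root, mul_comm]
    have h2 := congrArg (fun z => b.repr z j) h1
    simp only [map_sum, map_smul, map_zero, Finsupp.coe_zero, Pi.zero_apply,
      Finsupp.coe_finsetSum, Finset.sum_apply, Finsupp.coe_smul, Pi.smul_apply,
      smul_eq_mul] at h2
    rw [← h2]
    exact Finset.sum_congr rfl fun i _ => mul_comm _ _

/-- Clear denominators, lift the relation to `R`, trivialize it there. This is how regularity will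
pass to localizations. -/
theorem IsFrobeniusFlat.of_isLocalization {R : Type*} [CommRing R] {p e : ℕ}
    (h : IsFrobeniusFlat R p e) (M : Submonoid R) (A : Type*) [CommRing A] [Algebra R A]
    [IsLocalization M A] : IsFrobeniusFlat A p e := by
  intro r x a hxa
  obtain ⟨s, hs⟩ := IsLocalization.exist_integer_multiples_of_finite M x
  obtain ⟨t, ht⟩ := IsLocalization.exist_integer_multiples_of_finite M a
  choose x' hx' using hs
  choose a' ha' using ht
  have hsu := IsLocalization.map_units A s
  have htu := IsLocalization.map_units A t
  have h1 : algebraMap R A (∑ i, a' i * x' i ^ p ^ e) = algebraMap R A 0 := by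
    simp only [map_sum, map_mul, map_pow, hx', ha', Algebra.smul_def, mul_pow,
      map_zero]
    calc _ = algebraMap R A t * algebraMap R A s ^ p ^ e * ∑ i, a i * x i ^ p ^ e := by
          rw [Finset.mul_sum]
          exact Finset.sum_congr rfl fun i _ => by ring
      _ = 0 := by rw [hxa, mul_zero]
  obtain ⟨u, hu⟩ := (IsLocalization.eq_iff_exists M A).mp h1
  rw [mul_zero, Finset.mul_sum] at hu
  obtain ⟨N, b, c, hb, hc⟩ := h r x' (fun i => u * a' i) (by simpa only [mul_assoc] using hu)
  obtain ⟨w, hw⟩ := (((IsLocalization.map_units A u).mul htu)).exists_left_inv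
  refine ⟨N, fun i j => algebraMap R A (b i j), fun j => w * algebraMap R A (c j), fun i => ?_,
    fun j => ?_⟩
  · have h2 := congrArg (algebraMap R A) (hb i)
    simp only [map_sum, map_mul, map_pow, ha', Algebra.smul_def] at h2
    calc a i = w * (algebraMap R A u * (algebraMap R A t * a i)) := by
          rw [← mul_assoc (algebraMap R A u), ← mul_assoc w, hw, one_mul]
      _ = _ := by
          rw [h2, Finset.mul_sum]
          exact Finset.sum_congr rfl fun i _ => by ring
  · refine hsu.mul_left_cancel ?_
    rw [mul_zero, Finset.mul_sum, ← map_zero (algebraMap R A), ← hc j, map_sum]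
    refine Finset.sum_congr rfl fun i _ => ?_
    rw [map_mul, hx', Algebra.smul_def]
    ring

open IsLocalRing in
/-- **Kunz's theorem**: a noetherian local ring with flat Frobenius is regular. -/
theorem IsRegularLocalRing.of_isFrobeniusFlat {A : Type*} [CommRing A] [IsLocalRing A]
    [IsNoetherianRing A] {p : ℕ} (hp : 1 < p) [ExpChar A p] (h : ∀ e, IsFrobeniusFlat A p e) :
    IsRegularLocalRing A := by
  refine .of_spanFinrank_maximalIdeal_le A ?_
  obtain ⟨r, hr, x, hx, hmin⟩ : ∃ r, (maximalIdeal A).spanFinrank = r ∧ ∃ x : Fin r → A,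
      Ideal.span (Set.range x) = maximalIdeal A ∧ ∀ b : Fin r → A,
        ∑ i, b i * x i = 0 → ∀ i, b i ∈ maximalIdeal A := by
    obtain ⟨x, hx, hmin⟩ := (IsNoetherian.noetherian (maximalIdeal A)).exists_minimal_generators
    exact ⟨_, rfl, x, hx, fun b hb => hmin b (by simp [hb])⟩
  rw [hr]
  obtain ⟨s, hs, hcard⟩ := (maximalIdeal A).exists_finset_card_eq_height_of_isNoetherianRing
  rw [← maximalIdeal_height_eq_ringKrullDim, ← hcard]
  change ((r : ℕ) : WithBot ℕ∞) ≤ ((s.card : ℕ) : WithBot ℕ∞)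
  rw [Nat.cast_le]
  let y : Fin s.card → A := fun i => s.equivFin.symm i
  have hy : Set.range y = s := by
    ext z
    simp only [Set.mem_range, y, Finset.mem_coe]
    exact ⟨fun ⟨i, hi⟩ => hi ▸ Subtype.coe_prop _,
      fun hz => ⟨s.equivFin ⟨z, hz⟩, by simp⟩⟩
  have hart := quotient_artinian_of_mem_minimalPrimes_of_isLocalRing _ hs
  obtain ⟨C, hC⟩ : ∃ C : ℕ, Module.length A (A ⧸ Ideal.span (Set.range y)) = C := by
    rw [hy]
    rw [Module.length_eq_of_surjective (S := A) (R := A ⧸ Ideal.span (s : Set A))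
      Ideal.Quotient.mk_surjective]
    exact ENat.ne_top_iff_exists.mp Module.length_ne_top |>.imp fun _ h => h.symm
  -- Flatness makes the `q`-th powers of minimal generators of `m` Lech independent, so `A/m^[q]`
  -- has length at least `q ^ r`. It is a quotient of `A/(y ^ q)`, `y` a system of parameters, whose
  -- length is at most `q ^ dim A * C`.
  have hbound : ∀ e, (p ^ e) ^ r ≤ (p ^ e) ^ s.card * C := by
    intro e
    have hq : 0 < p ^ e := Nat.pow_pos (by omega)
    have hind : LechIndependent fun i => x i ^ p ^ e := by
      intro a ha i
      obtain ⟨N, b, c, hb, hc⟩ := h e r x a ha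
      rw [hb]
      refine sum_mem fun j _ => Ideal.mul_mem_right _ _ ?_
      have h1 := hmin (fun i => b i j) (hc j) i
      have h2 : (Ideal.span (x '' Set.univ)).map (iterateFrobenius A p e) =
          Ideal.span (Set.range fun i => x i ^ p ^ e) := by
        rw [Ideal.map_iterateFrobenius_span_image, Set.image_univ]
      rw [← h2, Set.image_univ]
      exact Ideal.mem_map_of_mem (iterateFrobenius A p e) (hx ▸ h1)
    have hne : Ideal.span (Set.range x) ≠ ⊤ := hx.trans_ne Ideal.IsPrime.ne_top'
    have h1 := hind.prod_le_length hne (fun _ => p ^ e) fun _ => hq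
    have h2 := length_quotient_span_pow_le y (fun _ => p ^ e) fun _ => hq
    have h3 : Ideal.span (Set.range fun i => y i ^ p ^ e) ≤
        Ideal.span (Set.range fun i => x i ^ p ^ e) := by
      simp only [← Set.image_univ, ← Ideal.map_iterateFrobenius_span_image]
      refine Ideal.map_mono ?_
      rw [Set.image_univ, Set.image_univ, hy]
      exact hs.1.2.trans hx.ge
    have h4 := Module.length_le_of_surjective (Submodule.factor h3) (Submodule.factor_surjective h3)
    have h5 := (h1.trans h4).trans h2
    rw [hC] at h5
    simp only [Finset.prod_const, Finset.card_univ, Fintype.card_fin] at h5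
    exact_mod_cast h5
  by_contra! hlt
  -- If `r` exceeded the dimension, then `q ≤ C` for every `q`; `q = p ^ C` violates this.
  have h1 := hbound C
  have h2 : 0 < p ^ C := Nat.pow_pos (by omega)
  have h3 : (p ^ C) ^ (s.card + 1) ≤ (p ^ C) ^ s.card * C :=
    (Nat.pow_le_pow_right h2 hlt).trans h1
  rw [pow_succ] at h3
  exact absurd (Nat.le_of_mul_le_mul_left h3 (Nat.pow_pos h2)) (not_le.mpr (Nat.lt_pow_self hp))

end

/-! ### The inclusion of `I ^ (h (q - 1) + 1)` in `I^[q]` -/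

theorem Ideal.sup_pow_add_one_le_pow_sup_pow {R : Type*} [CommRing R] (I J : Ideal R) (n m : ℕ) :
    (I ⊔ J) ^ (n + m + 1) ≤ I ^ (n + 1) ⊔ J ^ (m + 1) := by
  rw [← Ideal.add_eq_sup, ← Ideal.add_eq_sup, add_pow, Ideal.sum_eq_sup]
  refine Finset.sup_le fun i _ => Ideal.mul_le_left.trans ?_
  have hl : I ^ (n + 1) ≤ I ^ (n + 1) + J ^ (m + 1) := le_sup_left
  have hr : J ^ (m + 1) ≤ I ^ (n + 1) + J ^ (m + 1) := le_sup_right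
  by_cases hi : n + 1 ≤ i
  · exact (Ideal.mul_le_left.trans (Ideal.pow_le_pow_right hi)).trans hl
  · exact (Ideal.mul_le_right.trans (Ideal.pow_le_pow_right (by omega))).trans hr

/-- Pigeonhole: a monomial of degree above `T.card * n` has some exponent above `n`. -/
theorem Ideal.span_image_pow_le {R ι : Type*} [CommRing R] (x : ι → R) (n : ℕ) (T : Finset ι) :
    span (x '' T) ^ (T.card * n + 1) ≤ span ((fun i => x i ^ (n + 1)) '' T) := by
  classical
  induction T using Finset.induction_on with
  | empty => simp
  | insert i T hi ih =>
    rw [Finset.card_insert_of_notMem hi, Finset.coe_insert, Set.image_insert_eq,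
      Set.image_insert_eq, span_insert, span_insert, sup_comm (span {x i}),
      sup_comm (span {x i ^ (n + 1)}), add_mul, one_mul]
    refine (sup_pow_add_one_le_pow_sup_pow _ _ _ _).trans (sup_le_sup ih ?_)
    rw [span_singleton_pow]

section

variable {R : Type*} [CommRing R] (p e : ℕ) [ExpChar R p]

theorem Ideal.map_iterateFrobenius_comm {A : Type*} [CommRing A] [ExpChar A p] (f : R →+* A)
    (I : Ideal R) :
    (I.map (iterateFrobenius R p e)).map f = (I.map f).map (iterateFrobenius A p e) := by
  rw [Ideal.map_map, Ideal.map_map]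
  congr 1
  ext r
  simp [iterateFrobenius_def]

/-- In a regular local ring of dimension `h`, `m ^ (h (q - 1) + 1) ≤ m^[q]`. -/
theorem IsRegularLocalRing.maximalIdeal_pow_le [IsRegularLocalRing R] {h : ℕ}
    (hdim : ringKrullDim R = h) :
    maximalIdeal R ^ (h * (p ^ e - 1) + 1) ≤ (maximalIdeal R).map (iterateFrobenius R p e) := by
  obtain ⟨x, hx, -⟩ := (IsNoetherian.noetherian (maximalIdeal R)).exists_minimal_generators
  have hr : (maximalIdeal R).spanFinrank = h := by
    have := IsRegularLocalRing.spanFinrank_maximalIdeal (R := R)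
    rw [hdim] at this
    exact_mod_cast this
  have h1 := Ideal.span_image_pow_le x (p ^ e - 1) Finset.univ
  rw [Nat.sub_add_cancel (expChar_pow_pos R p e), ← Ideal.map_iterateFrobenius_span_image,
    Finset.card_univ, Fintype.card_fin, Finset.coe_univ, Set.image_univ] at h1
  have h2 : Ideal.span (Set.range x) = maximalIdeal R := hx
  rwa [h2, hr] at h1

/-- Associated primes of `R / I^[q]` are associated primes of `R / I`. -/
theorem IsAssociatedPrime.of_map_iterateFrobenius [IsNoetherianRing R]
    [Module.Free R (FrobRoot R p e)] [Module.Finite R (FrobRoot R p e)] {I P : Ideal R}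
    (h : IsAssociatedPrime P (R ⧸ I.map (iterateFrobenius R p e))) :
    IsAssociatedPrime P (R ⧸ I) := by
  have hq : p ^ e ≠ 0 := (expChar_pow_pos R p e).ne'
  rw [isAssociatedPrime_iff] at h ⊢
  obtain ⟨hP, z, hz⟩ := h
  refine ⟨hP, ?_⟩
  obtain ⟨z, rfl⟩ := Ideal.Quotient.mk_surjective z
  let b := Module.Free.chooseBasis R (FrobRoot R p e)
  -- As `P` is prime, `r` may be replaced by `r ^ q`, which acts on `z^{1/q}` coordinatewise. So `P`
  -- is a finite intersection of colons `(I : z_l)`, hence equal to one of them.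
  have hmem : ∀ r, r ∈ P ↔ ∀ l, r * b.repr (FrobRoot.root R p e z) l ∈ I := by
    intro r
    have h1 : r ∈ P ↔ r ^ p ^ e * z ∈ I.map (iterateFrobenius R p e) := by
      rw [← hP.pow_mem_iff_mem _ (Nat.pos_of_ne_zero hq), hz, Submodule.mem_colon_singleton,
        Submodule.mem_bot, Algebra.smul_def, Ideal.Quotient.algebraMap_eq, ← map_mul,
        Ideal.Quotient.eq_zero_iff_mem]
    rw [h1, ← FrobRoot.root_mem_map_algebraMap, b.mem_ideal_map_iff]
    refine forall_congr' fun l => ?_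
    rw [← FrobRoot.smul_root, map_smul]
    rfl
  have hcolon : ∀ r c, r ∈ (⊥ : Submodule R (R ⧸ I)).colon {Ideal.Quotient.mk I c} ↔
      r * c ∈ I := by
    intro r c
    rw [Submodule.mem_colon_singleton, Submodule.mem_bot, Algebra.smul_def,
      Ideal.Quotient.algebraMap_eq, ← map_mul, Ideal.Quotient.eq_zero_iff_mem]
  by_contra! hcon
  have hex : ∀ l, ∃ r, r * b.repr (FrobRoot.root R p e z) l ∈ I ∧ r ∉ P := by
    intro l
    by_contra! hl
    refine hcon (Ideal.Quotient.mk I (b.repr (FrobRoot.root R p e z) l)) (Ideal.ext fun r => ?_)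
    rw [hcolon]
    exact ⟨fun hr => (hmem r).mp hr l, hl r⟩
  choose r hr hrP using hex
  have h2 : ∏ l, r l ∈ P := by
    rw [hmem]
    intro l
    rw [← Finset.prod_erase_mul _ _ (Finset.mem_univ l), mul_assoc]
    exact I.mul_mem_left _ (hr l)
  obtain ⟨l, -, hl⟩ := (hP.prod_mem_iff).mp h2
  exact hrP l hl

/-- If `I` is an unmixed radical ideal of height `h` in a regular local ring, then
`I ^ (h (q - 1) + 1) ≤ I^[q]`. -/
theorem Ideal.IsHeightUnmixed.pow_le_map_iterateFrobenius [IsRegularLocalRing R] (hp : 1 < p)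
    (hfin : IsFFinite R p) {I : Ideal R} (hrad : I.IsRadical) (hunm : I.IsHeightUnmixed) {h : ℕ}
    (hh : I.height = h) : I ^ (h * (p ^ e - 1) + 1) ≤ I.map (iterateFrobenius R p e) := by
  have := isDomain_of_isRegularLocalRing R
  have hF := fun e => FrobRoot.finite_of_isFFinite p e hfin
  have hF' := fun e => FrobRoot.free_of_isFFinite p e hfin
  intro y hy
  by_contra hcon
  obtain ⟨Q, hQ, hyQ⟩ := exists_le_isAssociatedPrime_of_isNoetherianRing R
    (Ideal.Quotient.mk (I.map (iterateFrobenius R p e)) y)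
    (by rwa [Ne, Ideal.Quotient.eq_zero_iff_mem])
  have hQI := IsAssociatedPrime.of_map_iterateFrobenius p e hQ
  have hQp : Q.IsPrime := hQ.1
  have hQh : Q.height = h := (hunm Q hQI).trans hh
  have hIQ : I ≤ Q := by
    obtain ⟨-, z, hz⟩ := isAssociatedPrime_iff.mp hQI
    intro r hr
    obtain ⟨z, rfl⟩ := Ideal.Quotient.mk_surjective z
    rw [hz, Submodule.mem_colon_singleton, Submodule.mem_bot, Algebra.smul_def,
      Ideal.Quotient.algebraMap_eq, ← map_mul, Ideal.Quotient.eq_zero_iff_mem]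
    exact I.mul_mem_right _ hr
  have hmin : Q ∈ I.minimalPrimes := Ideal.mem_minimalPrimes_of_height_le hIQ (by rw [hQh, hh])
  let A := Localization.AtPrime Q
  have hinj : Function.Injective (algebraMap R A) :=
    IsLocalization.injective A Q.primeCompl_le_nonZeroDivisors
  have : ExpChar A p := expChar_of_injective_algebraMap hinj p
  have : IsNoetherianRing A := IsLocalization.isNoetherianRing Q.primeCompl A inferInstance
  -- Both directions of Kunz's theorem: freeness over `R` gives flatness, which localizes and gives
  -- regularity back.
  have : IsRegularLocalRing A := .of_isFrobeniusFlat hp fun e =>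
    (isFrobeniusFlat_of_free R p e).of_isLocalization Q.primeCompl A
  have hmap : I.map (algebraMap R A) = maximalIdeal A := by
    refine le_antisymm ?_ ?_
    · rw [← Localization.AtPrime.map_eq_maximalIdeal]
      exact Ideal.map_mono hIQ
    · rw [← Localization.AtPrime.map_eq_maximalIdeal, Ideal.map_le_iff_le_comap]
      intro z hz
      have h1 := Ideal.mem_map_of_mem (algebraMap R A) hz
      rw [← IsLocalization.AtPrime.radical_map_of_mem_minimalPrimes A Q I hmin] at h1
      obtain ⟨n, hn⟩ := h1
      rw [← map_pow] at hn
      obtain ⟨⟨j, s⟩, hjs⟩ := (IsLocalization.mem_map_algebraMap_iff Q.primeCompl A).mp hn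
      rw [← map_mul] at hjs
      have h2 : z ^ n * s ∈ I := hinj hjs ▸ j.2
      have h3 : z * s ∈ I := hrad ⟨n + 1, by
        have : (z * (s : R)) ^ (n + 1) = z * (s : R) ^ n * (z ^ n * s) := by ring
        rw [this]
        exact I.mul_mem_left _ h2⟩
      exact (IsLocalization.mem_map_algebraMap_iff Q.primeCompl A).mpr
        ⟨⟨⟨_, h3⟩, s⟩, (map_mul _ _ _).symm⟩
  have h1 : algebraMap R A y ∈ (I.map (iterateFrobenius R p e)).map (algebraMap R A) := by
    rw [Ideal.map_iterateFrobenius_comm, hmap]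
    refine IsRegularLocalRing.maximalIdeal_pow_le p e (h := h) ?_ ?_
    · rw [IsLocalization.AtPrime.ringKrullDim_eq_height Q A, hQh]
      rfl
    · rw [← hmap, ← Ideal.map_pow]
      exact Ideal.mem_map_of_mem _ hy
  obtain ⟨⟨j, s⟩, hjs⟩ := (IsLocalization.mem_map_algebraMap_iff Q.primeCompl A).mp h1
  rw [← map_mul] at hjs
  have h2 : y * s ∈ I.map (iterateFrobenius R p e) := hinj hjs ▸ j.2
  refine s.2 (hyQ ?_)
  rw [Submodule.mem_colon_singleton, Submodule.mem_bot, Algebra.smul_def,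
    Ideal.Quotient.algebraMap_eq, ← map_mul, Ideal.Quotient.eq_zero_iff_mem, mul_comm]
  exact h2

end

/-! ### Strongly F-regular pairs -/

section

variable {S : Type*} [CommRing S] (p : ℕ) [ExpChar S p]

/-- Restrict the splitting along the natural map from `S^{1/q}` to `S^{1/qq'}`, which in terms of
numerators is `z ↦ z ^ q'`. -/
theorem RootSplits.one_of_add {e e' : ℕ} (h : RootSplits p (e + e') (1 : S)) :
    RootSplits p e (1 : S) := by
  rw [rootSplits_iff] at h ⊢
  obtain ⟨φ, hφ⟩ := h
  have hφs : ∀ r z : S, φ (FrobRoot.root S p (e + e') (r ^ p ^ (e + e') * z)) =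
      r * φ (FrobRoot.root S p (e + e') z) := fun r z => φ.map_smul r _
  refine ⟨{ toFun := fun z => φ (FrobRoot.root S p (e + e')
              (((FrobRoot.root S p e).symm z) ^ p ^ e'))
            map_add' := fun a b => by simp only [map_add, add_pow_expChar_pow]
            map_smul' := fun r z => ?_ }, ?_⟩
  · obtain ⟨z, rfl⟩ := (FrobRoot.root S p e).surjective z
    rw [FrobRoot.smul_root, RingEquiv.symm_apply_apply, RingEquiv.symm_apply_apply, mul_pow,
      ← pow_mul, ← pow_add, hφs]
    rfl
  · rw [LinearMap.coe_mk, AddHom.coe_mk, RingEquiv.symm_apply_apply, one_pow, hφ]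

theorem RootSplits.one_of_pos {e : ℕ} (he : 0 < e) (h : RootSplits p e (1 : S)) (r : ℕ) :
    RootSplits p r (1 : S) := by
  have h1 : ∀ n, RootSplits p (n * e) (1 : S) := by
    intro n
    induction n with
    | zero => rw [zero_mul]; exact RootSplits.one_of_add p (e' := e) (by rwa [zero_add])
    | succ n ih => simpa [add_mul] using ih.comp p (n * e) h
  refine RootSplits.one_of_add p (e' := r * e - r) ?_
  rw [Nat.add_sub_cancel' (Nat.le_mul_of_pos_right r he)]
  exact h1 r

theorem memCirc_iff_ne_zero [IsDomain S] {c : S} : MemCirc c ↔ c ≠ 0 := by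
  rw [MemCirc, IsDomain.minimalPrimes_eq_singleton_bot]
  simp

variable {k : ℕ} {a : Fin k → Ideal S} {t : Fin k → ℝ}

/-- Take `x` in exactly the minimal prime `P`, and `y` in exactly the others. Then `x y = 0` and `x
+ y` is a legitimate test element; a splitting writes `1 = φ (x d) + φ (y d)`. One summand is a
unit, but `y` kills the first and `x` the second, so `y = 0` or `x = 0`. The former is absurd, the
latter leaves `P` as the only minimal prime. -/
theorem IsStronglyFRegularPair.isDomain [IsLocalRing S] [IsNoetherianRing S] [IsReduced S]
    (h : IsStronglyFRegularPair p a t) : IsDomain S := by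
  obtain ⟨P, hP⟩ := Ideal.nonempty_minimalPrimes (I := (⊥ : Ideal S)) bot_ne_top
  have hPp : P.IsPrime := hP.1.1
  have hfin : (minimalPrimes S).Finite := Ideal.finite_minimalPrimes_of_isNoetherianRing S ⊥
  have hnil : ∀ z, (∀ P' ∈ minimalPrimes S, z ∈ P') → z = 0 := by
    intro z hz
    have h1 : z ∈ sInf (⊥ : Ideal S).minimalPrimes := Ideal.mem_sInf.mpr fun {P'} hP' => hz P' hP'
    rw [Ideal.sInf_minimalPrimes] at h1
    have h2 : (⊥ : Ideal S).radical = ⊥ := nilradical_eq_zero S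
    simpa [h2] using h1
  let s : Finset (Ideal S) := (hfin.subset (Set.sdiff_subset (t := {P}))).toFinset
  have hs : ∀ P', P' ∈ s ↔ P' ∈ minimalPrimes S ∧ P' ≠ P := by simp [s]
  obtain ⟨x, hxP, hx⟩ : ∃ x ∈ P, ∀ P' ∈ s, x ∉ P' := by
    by_contra! hcon
    obtain ⟨P', hP', hle⟩ := (Ideal.subset_union_prime (s := s) (f := id) (I := P) P P
      (fun P' hP' _ _ => ((hs P').mp hP').1.1.1)).mp fun x hx => by
        obtain ⟨P', hP', hx'⟩ := hcon x hx
        exact Set.mem_biUnion hP' hx'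
    have h1 := ((hs P').mp hP')
    exact h1.2 (le_antisymm (h1.1.2 ⟨hPp, bot_le⟩ hle) hle)
  obtain ⟨y, hy, hyP⟩ : ∃ y, (∀ P' ∈ s, y ∈ P') ∧ y ∉ P := by
    by_contra! hcon
    obtain ⟨P', hP', hle⟩ := (hPp.inf_le' (s := s) (f := id)).mp fun y hy =>
      hcon y fun P' hP' => (Finset.inf_le (f := id) hP' : s.inf id ≤ P') hy
    have h1 := ((hs P').mp hP')
    exact h1.2 (le_antisymm hle (hP.2 h1.1.1 hle))
  have hxy : x * y = 0 := hnil _ fun P' hP' => by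
    by_cases hPP : P' = P
    · exact hPP ▸ Ideal.mul_mem_right _ _ hxP
    · exact Ideal.mul_mem_left _ _ (hy P' ((hs P').mpr ⟨hP', hPP⟩))
  have hc : MemCirc (x + y) := fun P' hP' hmem => by
    by_cases hPP : P' = P
    · subst hPP
      exact hyP ((Ideal.add_mem_iff_right _ hxP).mp hmem)
    · have h1 := (hs P').mpr ⟨hP', hPP⟩
      exact hx P' h1 ((Ideal.add_mem_iff_left _ (hy P' h1)).mp hmem)
  obtain ⟨e, -, d, -, hd⟩ := h _ hc
  obtain ⟨φ, hφ⟩ := (rootSplits_iff p e).mp hd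
  have hφs : ∀ r z : S, φ (FrobRoot.root S p e (r ^ p ^ e * z)) =
      r * φ (FrobRoot.root S p e z) := fun r z => φ.map_smul r _
  obtain ⟨q, hq⟩ := Nat.exists_eq_add_one.mpr (expChar_pow_pos S p e)
  have h1 : y * φ (FrobRoot.root S p e (x * d)) = 0 := by
    rw [← hφs, hq, show y ^ (q + 1) * (x * d) = x * y * (y ^ q * d) by ring, hxy, zero_mul, map_zero,
      map_zero]
  have h2 : x * φ (FrobRoot.root S p e (y * d)) = 0 := by
    rw [← hφs, hq, show x ^ (q + 1) * (y * d) = x * y * (x ^ q * d) by ring, hxy, zero_mul, map_zero,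
      map_zero]
  rw [add_mul, map_add, map_add] at hφ
  rcases IsLocalRing.isUnit_or_isUnit_of_add_one hφ with hu | hu
  · exact absurd (hu.mul_left_eq_zero.mp h1 ▸ P.zero_mem) hyP
  · have hx0 := hu.mul_left_eq_zero.mp h2
    have hPbot : P = ⊥ := by
      rw [eq_bot_iff]
      intro z hz
      refine hnil z fun P' hP' => ?_
      by_cases hPP : P' = P
      · exact hPP ▸ hz
      · exact absurd (hx0 ▸ P'.zero_mem) (hx P' ((hs P').mpr ⟨hP', hPP⟩))
    subst hPbot
    exact IsDomain.of_bot_isPrime S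

/-- For large `q` the exponent of a zero ideal is positive and no `d ≠ 0` is available. Small `q`
are excluded by testing with `x ^ p ^ E`, `x` a nonunit, from which a nonunit scalar can be pulled
out. Over a field there is no such `x`. -/
theorem IsStronglyFRegularPair.ne_bot [IsDomain S] (hp : 1 < p)
    (hS : ¬ IsField S) (ht : ∀ i, 0 < t i) (h : IsStronglyFRegularPair p a t) (i : Fin k) :
    a i ≠ ⊥ := by
  intro hai
  obtain ⟨x, hx0, hx⟩ : ∃ x : S, x ≠ 0 ∧ ¬ IsUnit x := by
    by_contra! hcon
    exact hS ⟨⟨0, 1, zero_ne_one⟩, mul_comm, fun {x} hx => (hcon x hx).exists_right_inv⟩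
  obtain ⟨E, hE⟩ : ∃ E : ℕ, 1 / t i + 1 < (p : ℝ) ^ E :=
    pow_unbounded_of_one_lt _ (by exact_mod_cast hp)
  obtain ⟨e, -, d, hd, hsp⟩ := h (x ^ p ^ E) ((memCirc_iff_ne_zero).mpr (pow_ne_zero _ hx0))
  obtain ⟨φ, hφ⟩ := (rootSplits_iff p e).mp hsp
  have hφs : ∀ r z : S, φ (FrobRoot.root S p e (r ^ p ^ e * z)) =
      r * φ (FrobRoot.root S p e z) := fun r z => φ.map_smul r _
  rcases le_or_gt E e with hEe | hEe
  · have h1 : 1 ≤ ⌊t i * ((p : ℝ) ^ e - 1)⌋₊ := by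
      rw [Nat.one_le_floor_iff, ← div_le_iff₀' (ht i)]
      have : (p : ℝ) ^ E ≤ (p : ℝ) ^ e := pow_le_pow_right₀ (by exact_mod_cast hp.le) hEe
      linarith
    have h2 : floorPower p a t e = ⊥ := by
      refine Finset.prod_eq_zero (Finset.mem_univ i) ?_
      rw [hai, ← Ideal.zero_eq_bot, zero_pow (by omega)]
    rw [h2, Ideal.mem_bot] at hd
    rw [hd, mul_zero, map_zero, map_zero] at hφ
    exact zero_ne_one hφ
  · obtain ⟨j, rfl⟩ := Nat.exists_eq_add_of_lt hEe
    rw [show e + j + 1 = (j + 1) + e by ring, pow_add p, pow_mul, hφs] at hφ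
    exact hx ((isUnit_pow_iff (Nat.pow_pos (by omega)).ne').mp (IsUnit.of_mul_eq_one _ hφ))

/-- Compose one splitting at `e₁` with splittings of `1` at every `r` to reach all `e ≥ e₁`. The
rounding lost in the exponents is repaid by putting `b ^ M`, with `b` in all the ideals, into the
test element. -/
theorem IsStronglyFRegularPair.exists_forall_ge [IsDomain S] (hp : 1 < p) (ha : ∀ i, a i ≠ ⊥)
    (h : IsStronglyFRegularPair p a t) {c : S} (hc : c ≠ 0) :
    ∃ e₀ : ℕ, ∀ e : ℕ, e₀ ≤ e → ∃ d ∈ floorPower p a t e, RootSplits p e (c * d) := by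
  obtain ⟨b, hb, hb0⟩ : ∃ b ∈ ∏ i, a i, b ≠ 0 :=
    Submodule.exists_mem_ne_zero_of_ne_bot (Finset.prod_ne_zero_iff.mpr fun i _ => ha i)
  obtain ⟨M, hM⟩ : ∃ M : ℕ, ∀ i, t i + 1 ≤ M := by
    obtain ⟨B, hB⟩ := (Set.finite_range t).bddAbove
    obtain ⟨M, hM⟩ := exists_nat_ge (B + 1)
    exact ⟨M, fun i => le_trans (by linarith [hB ⟨i, rfl⟩]) hM⟩
  obtain ⟨e₁, he₁, d, hd, hsp⟩ := h (c * b ^ M)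
    (memCirc_iff_ne_zero.mpr (mul_ne_zero hc (pow_ne_zero _ hb0)))
  have hone : RootSplits p e₁ (1 : S) := RootSplits.of_mul p e₁ (c := c * b ^ M * d) (by simpa)
  refine ⟨e₁, fun e he => ?_⟩
  obtain ⟨r, rfl⟩ := Nat.exists_eq_add_of_le he
  have hr := hsp.comp p e₁ (hone.one_of_pos p he₁ r)
  obtain ⟨s, hs⟩ := Nat.exists_eq_add_one.mpr (expChar_pow_pos S p r)
  refine ⟨c ^ s * ((b ^ M) ^ p ^ r * d ^ p ^ r), Ideal.mul_mem_left _ _ ?_, ?_⟩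
  · have h1 := Ideal.mul_mem_mul (Ideal.pow_mem_pow (Ideal.pow_mem_pow hb M) (p ^ r))
      (Ideal.pow_mem_pow hd (p ^ r))
    refine (?_ : _ ≤ floorPower p a t (e₁ + r)) h1
    rw [floorPower, floorPower, ← Finset.prod_pow, ← Finset.prod_pow, ← Finset.prod_pow,
      ← Finset.prod_mul_distrib]
    refine Finset.prod_le_prod' fun i _ => ?_
    -- With `Q = p ^ e₁` and `q = p ^ r`: for `t ≥ 0`, `M ≥ t + 1` gives `(⌊t (Q - 1)⌋ + M) q ≥ t Q
    -- q ≥ t (Q q - 1)`.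
    rw [← pow_mul, ← pow_mul, ← pow_add, ← add_mul]
    refine Ideal.pow_le_pow_right (Nat.floor_le_of_le ?_)
    push_cast
    have h2 := (Nat.lt_floor_add_one (t i * ((p : ℝ) ^ e₁ - 1))).le
    have h3 : (0 : ℝ) < (p : ℝ) ^ r := pow_pos (by exact_mod_cast (by omega : 0 < p)) r
    have h4 := hM i
    rw [pow_add]
    by_cases hti : 0 ≤ t i
    · nlinarith
    · have h5 : 1 ≤ (p : ℝ) ^ e₁ * (p : ℝ) ^ r :=
        one_le_mul_of_one_le_of_one_le (one_le_pow₀ (by exact_mod_cast hp.le))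
          (one_le_pow₀ (by exact_mod_cast hp.le))
      have h6 : t i * ((p : ℝ) ^ e₁ * (p : ℝ) ^ r - 1) ≤ 0 :=
        mul_nonpos_of_nonpos_of_nonneg (le_of_not_ge hti) (by linarith)
      exact h6.trans (by positivity)
  · convert hr using 1
    rw [hs]
    ring

end

/-! ### Transfer between `R` and `R/I`, and the theorem -/

section

variable {R : Type*} [CommRing R] {k : ℕ} (p e : ℕ)

theorem floorPower_cons (I : Ideal R) (a : Fin k → Ideal R) (c : ℝ) (t : Fin k → ℝ) :
    floorPower p (Fin.cons I a : Fin (k + 1) → Ideal R) (Fin.cons c t : Fin (k + 1) → ℝ) e =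
      I ^ ⌊c * ((p : ℝ) ^ e - 1)⌋₊ * floorPower p a t e := by
  simp [floorPower, Fin.prod_univ_succ]

theorem floor_natCast_mul_pow_sub_one (hp : 0 < p) (h : ℕ) :
    ⌊(h : ℝ) * ((p : ℝ) ^ e - 1)⌋₊ = h * (p ^ e - 1) := by
  have : (h : ℝ) * ((p : ℝ) ^ e - 1) = ((h * (p ^ e - 1) : ℕ) : ℝ) := by
    rw [Nat.cast_mul, Nat.cast_sub (Nat.one_le_pow _ _ hp)]
    simp
  rw [this, Nat.floor_natCast]

theorem floorPower_map {S : Type*} [CommRing S] (f : R →+* S) (a : Fin k → Ideal R)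
    (t : Fin k → ℝ) :
    floorPower p (fun i => (a i).map f) t e = (floorPower p a t e).map f := by
  rw [floorPower, floorPower, ← Ideal.mapHom_apply, map_prod]
  simp [Ideal.map_pow]

variable [IsRegularLocalRing R] [ExpChar R p] {I : Ideal R} [ExpChar (R ⧸ I) p]
  {a : Fin k → Ideal R} {t : Fin k → ℝ}

/-- Fedder's multiplier `u` lies in `I ^ (q - 1)`, so it supplies the factor from `I` that the pair
on `R` demands. -/
theorem exists_rootSplits_of_quotient (hp : 1 < p) (hfin : IsFFinite R p) (hI : I ≠ ⊤)
    (hI0 : I ≠ ⊥) {c : R}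
    (h : ∃ d ∈ floorPower p (fun i => (a i).map (Ideal.Quotient.mk I)) t e,
      RootSplits p e (Ideal.Quotient.mk I c * d)) :
    ∃ d ∈ floorPower p (Fin.cons I a : Fin (k + 1) → Ideal R)
        (Fin.cons 1 t : Fin (k + 1) → ℝ) e, RootSplits p e (c * d) := by
  obtain ⟨d, hd, hsp⟩ := h
  rw [floorPower_map] at hd
  obtain ⟨d, hd', rfl⟩ :=
    (Ideal.mem_map_iff_of_surjective _ Ideal.Quotient.mk_surjective).mp hd
  rw [← map_mul] at hsp
  obtain ⟨u, hu, hud⟩ := RootSplits.exists_notMem_map p e hfin hI hsp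
  have huI := IsRegularLocalRing.mem_pow_of_mul_mem_map_iterateFrobenius p e hp hfin hI0 hu
  refine ⟨u * d, ?_, rootSplits_of_notMem_map p e hfin (by rwa [mul_left_comm])⟩
  have h1 := floor_natCast_mul_pow_sub_one p e (by omega) 1
  rw [Nat.cast_one, one_mul (p ^ e - 1)] at h1
  rw [floorPower_cons, h1]
  exact Ideal.mul_mem_mul huI hd'

/-- The factor from `I ^ (h (q - 1))` multiplies `I` into `I^[q]`, so it serves as Fedder's
multiplier. -/
theorem exists_rootSplits_quotient (hp : 1 < p) (hfin : IsFFinite R p)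
    (hrad : I.IsRadical) (hunm : I.IsHeightUnmixed) {h : ℕ} (hh : I.height = h) {c : R}
    (hd : ∃ d ∈ floorPower p (Fin.cons I a : Fin (k + 1) → Ideal R)
      (Fin.cons (h : ℝ) t : Fin (k + 1) → ℝ) e, RootSplits p e (c * d)) :
    ∃ d ∈ floorPower p (fun i => (a i).map (Ideal.Quotient.mk I)) t e,
      RootSplits p e (Ideal.Quotient.mk I c * d) := by
  obtain ⟨d, hd, hsp⟩ := hd
  rw [floorPower_cons, floor_natCast_mul_pow_sub_one p e (by omega)] at hd
  -- `d` is only a sum of products; since `c d ∉ m^[q]`, at least one product stays outside `m^[q]`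
  -- after multiplication by `c`.
  obtain ⟨x, hx, y, hy, hxy⟩ : ∃ x ∈ I ^ (h * (p ^ e - 1)), ∃ y ∈ floorPower p a t e,
      c * (x * y) ∉ (maximalIdeal R).map (iterateFrobenius R p e) := by
    by_contra! hcon
    refine hsp.notMem_map p e ?_
    refine Submodule.mul_induction_on hd hcon fun z w hz hw => ?_
    rw [mul_add]
    exact add_mem hz hw
  refine ⟨Ideal.Quotient.mk I y, ?_, ?_⟩
  · rw [floorPower_map]
    exact Ideal.mem_map_of_mem _ hy
  · rw [← map_mul]
    refine rootSplits_quotient_of_notMem_map p e hfin (u := x) (fun z hz => ?_)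
      (by rwa [mul_left_comm])
    refine hunm.pow_le_map_iterateFrobenius p e hp hfin hrad hh ?_
    rw [pow_succ]
    exact Ideal.mul_mem_mul hx hz

end

theorem theorem3p11 {R : Type*} [CommRing R] [IsRegularLocalRing R]
    (p : ℕ) [Fact p.Prime] [CharP R p] (hfin : IsFFinite R p)
    (I : Ideal R) (hI : I ≠ ⊤) (hrad : I.IsRadical) (hunm : I.IsHeightUnmixed)
    (h : ℕ) (hpos : 0 < h) (hh : I.height = (h : ℕ∞))
    {k : ℕ} (a : Fin k → Ideal R) (t : Fin k → ℝ) (ht : ∀ i, 0 < t i) :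
    haveI : CharP (R ⧸ I) p := charP_quotient_of_ne_top p hI
    ((IsField (R ⧸ I) → ∀ i, (a i).map (Ideal.Quotient.mk I) ≠ ⊥) →
      IsStronglyFRegularPair p (fun i => (a i).map (Ideal.Quotient.mk I)) t →
        IsPurelyFRegularPair p (Fin.cons I a : Fin (k + 1) → Ideal R)
          (Fin.cons 1 t : Fin (k + 1) → ℝ)) ∧
    (IsFPurePair p (fun i => (a i).map (Ideal.Quotient.mk I)) t →
      IsFPurePair p (Fin.cons I a : Fin (k + 1) → Ideal R)
        (Fin.cons 1 t : Fin (k + 1) → ℝ)) ∧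
    (IsFPurePair p (Fin.cons I a : Fin (k + 1) → Ideal R)
        (Fin.cons (h : ℝ) t : Fin (k + 1) → ℝ) →
      IsFPurePair p (fun i => (a i).map (Ideal.Quotient.mk I)) t) ∧
    ((∀ i, I ≤ a i) →
      IsPurelyFRegularPair p (Fin.cons I a : Fin (k + 1) → Ideal R)
        (Fin.cons (h : ℝ) t : Fin (k + 1) → ℝ) →
      IsStronglyFRegularPair p (fun i => (a i).map (Ideal.Quotient.mk I)) t) := by
  have : CharP (R ⧸ I) p := charP_quotient_of_ne_top p hI
  have hp : 1 < p := (Fact.out : p.Prime).one_lt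
  have := isDomain_of_isRegularLocalRing R
  have hI0 : I ≠ ⊥ := by
    rintro rfl
    rw [Ideal.height_bot] at hh
    exact hpos.ne (by exact_mod_cast hh)
  have : Nontrivial (R ⧸ I) := Ideal.Quotient.nontrivial_iff.mpr hI
  have : IsLocalRing (R ⧸ I) := .of_surjective' (Ideal.Quotient.mk I) Ideal.Quotient.mk_surjective
  have : IsReduced (R ⧸ I) := (Ideal.isRadical_iff_quotient_reduced I).mp hrad
  have hprod : ∏ i, (Fin.cons I a : Fin (k + 1) → Ideal R) i = I * ∏ i, a i := by
    simp [Fin.prod_univ_succ]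
  have hle : I * ∏ i, a i ≤ I := Ideal.mul_le_left
  refine ⟨fun hfield hS c hc hcmin => ?_, fun ⟨e₀, he₀⟩ => ⟨e₀, fun e he => ?_⟩,
    fun ⟨e₀, he₀⟩ => ⟨e₀, fun e he => ?_⟩, fun ha hR c hc => ?_⟩
  · have hdom := hS.isDomain p
    have hne : ∀ i, (a i).map (Ideal.Quotient.mk I) ≠ ⊥ := by
      by_cases hf : IsField (R ⧸ I)
      · exact hfield hf
      · exact hS.ne_bot p hp hf ht
    have hIp : I.IsPrime := (Ideal.Quotient.isDomain_iff_prime I).mp hdom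
    have hc0 : Ideal.Quotient.mk I c ≠ 0 := by
      rw [Ne, Ideal.Quotient.eq_zero_iff_mem]
      rw [hprod] at hcmin
      -- No `a i` lies in the prime `I`, so `I` is a minimal prime of the product and `c` avoids it.
      refine hcmin I ⟨⟨hIp, hle⟩, fun Q hQ hQI => ?_⟩
      obtain ⟨hQp, hQ⟩ := hQ
      refine (hQp.mul_le.mp hQ).resolve_right fun hQ => ?_
      obtain ⟨i, -, hi⟩ := (hQp.prod_le).mp hQ
      refine hne i ?_
      rw [Ideal.map_eq_bot_iff_le_ker, Ideal.mk_ker]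
      exact hi.trans hQI
    obtain ⟨e₀, he₀⟩ := hS.exists_forall_ge p hp hne hc0
    exact ⟨e₀, fun e he => exists_rootSplits_of_quotient p e hp hfin hI hI0 (he₀ e he)⟩
  · obtain ⟨d, hd, hsp⟩ := he₀ e he
    obtain ⟨d', hd', hsp'⟩ := exists_rootSplits_of_quotient p e hp hfin hI hI0 (c := 1)
      ⟨d, hd, by simpa using hsp⟩
    exact ⟨d', hd', by simpa using hsp'⟩
  · obtain ⟨d, hd, hsp⟩ := he₀ e he
    obtain ⟨d', hd', hsp'⟩ := exists_rootSplits_quotient p e hp hfin hrad hunm hh (c := 1)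
      ⟨d, hd, by simpa using hsp⟩
    exact ⟨d', hd', by simpa using hsp'⟩
  · obtain ⟨c, rfl⟩ := Ideal.Quotient.mk_surjective c
    have hc' : ∀ P ∈ I.minimalPrimes, c ∉ P := by
      intro P hP hcP
      rw [Ideal.minimalPrimes_eq_comap] at hP
      obtain ⟨P', hP', rfl⟩ := hP
      exact hc P' hP' hcP
    have hc0 : c ≠ 0 := by
      rintro rfl
      obtain ⟨P, hP⟩ := Ideal.nonempty_minimalPrimes hI
      exact hc' P hP P.zero_mem
    -- As `I ≤ a i`, a prime containing the product contains `I`, so each minimal prime of the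
    -- product is minimal over `I`.
    obtain ⟨e₀, he₀⟩ := hR c (memCirc_iff_ne_zero.mpr hc0) fun P hP => by
      rw [hprod] at hP
      have hPp : P.IsPrime := hP.1.1
      refine hc' P ⟨⟨hPp, ?_⟩, fun Q hQ hQP => hP.2 ⟨hQ.1, hle.trans hQ.2⟩ hQP⟩
      rcases hPp.mul_le.mp hP.1.2 with hi | hi
      · exact hi
      · obtain ⟨i, -, hi⟩ := (hPp.prod_le).mp hi
        exact (ha i).trans hi
    -- The maximum with `1` secures the positive exponent that strong F-regularity asks for.
    exact ⟨max e₀ 1, by simp, exists_rootSplits_quotient p _ hp hfin hrad hunm hh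
      (he₀ _ (le_max_left _ _))⟩
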